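/- **Setting.** Let $p$ be a prime and let $G$ be the Vilenkin group of sequences $x=(x_k)_{k\in\mathbb Z}$, $x_k\in\mathbb Z/p$, with $x_k=0$ for all sufficiently small $k$, with coordinatewise addition and with the topology whose base is formed by the cosets of the subgroups $G_n=\{x: x_k=0 \text{ for } k<n\}$. Let $\mu$ be the Haar measure with $\mu(G_0)=1$, let $\mathcal A$ be the dilation $(\mathcal Ax)_k=x_{k+1}$ and $H_0=\{h\in G: h_k=0 \text{ for } k\ge 0\}$. Let $X$ be the group of continuous characters of $G$, $G_n^\perp$ the annihilator of $G_n$, $\nu$ the Haar measure on $X$ with $\nu(G_0^\perp)=1$, and $(\chi\mathcal A^j)(x)=\chi(\mathcal A^jx)$. Put $\|\chi\|=p^n$ for $\chi\in G_n^\perp\setminus G_{n-1}^\perp$, and $\log_p^+\|\chi\|=\log_p\|\chi\|$ if $\|\chi\|>1$, $\log_p^+\|\chi\|=1$ if $\|\chi\|\le 1$. The Fourier transform of $f\in L_2(G)$ is $\hat f(\chi)=\lim_{n\to\infty}\int_{G_{-n}}f(x)\overline{\chi(x)}\,d\mu(x)$ (limit in $L_2(X)$). Let $M,N\ge1$ and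 let $\varphi$ be a function supported in $G_{-N}$, constant on the cosets of $G_M$, and refinable: $\varphi(x)=p\sum_{h\in H_0}\beta_h\varphi(\mathcal Ax-h)$ with $(\beta_h)\in\ell^2$. Let $m_1,\dots,m_q$ be functions on $X$ (masks) with $\hat\varphi(\chi\mathcal A^{-1})m_j(\chi)=\mathbf 1_{E_j}(\chi)$, where $E_j$ are pairwise disjoint sets, $E_j$ is a coset of $G_{-s(j)}^\perp$ with $s(j)\ge0$, and suppose that there are integers $t(j)\ge0$ such that the sets $E_j\mathcal A^{t(j)}$ are pairwise disjoint with union $G_{M+1}^\perp\setminus G_M^\perp$. Let $\psi^{(j)}\in L_2(G)$ be given by $\hat\psi^{(j)}(\chi)=\hat\varphi(\chi\mathcal A^{-1})m_j(\chi)$, put $\psi^{(j)}_{n,h}(x)=p^{n/2}\psi^{(j)}(\mathcal A^nx-h)$, $l=\max_jt(j)$, and $$R_{\tilde N}=\Big\|f-\sum_{n\le\tilde N}\sum_{j=1}^q\sum_{h\in H_0}\langle f,\psi^{(j)}_{n,h}\rangle\psi^{(j)}_{n,h}\Big\|_{2}.$$ **Statement.** Let $f\in L_2(G)$ and let $\tilde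 N>N$ be an integer. Then $\hat f$ exists, the series in $R_{\tilde N}$ converges unconditionally in $L_2(G)$, and the following hold (integrals on the right may be $+\infty$). 1. Let $(\gamma_n)_{n\in\mathbb Z}$ be positive, with $\gamma_n=1$ for $n<0$, non-decreasing on $n\ge0$, $\sum_{n\ge0}1/\gamma_n<\infty$, and let $\gamma(\chi)=\gamma_n$ for $\chi\in G_n^\perp\setminus G_{n-1}^\perp$. Then $$R_{\tilde N}\le(N+1)p^{M/2}\Big(\int_X\gamma^2(\chi\mathcal A^l)|\hat f(\chi)|^2d\nu(\chi)\Big)^{1/2}\sum_{n=\tilde N+1}^\infty\frac1{\gamma_{n+1}}.$$ 2. For every real $m>0$, $$R_{\tilde N}\le\frac{N+1}{(p^m-1)p^{m(\tilde N+2)}}\Big(\int_X\big(1+p^{lm}\|\chi\|^m\big)^2|\hat f(\chi)|^2d\nu(\chi)\Big)^{1/2}$$ and $$R_{\tilde N}\le\frac{(N+1)\,p^{lm}}{(p^m-1)p^{m(\tilde N+2)}}\Big(\int_X\big(1+\|\chi\|^{m+l}\big)^2|\hat f(\chi)|^2d\nu(\chi)\Big)^{1/2};$$ in particular $R_{\tilde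 N}=O(p^{-m\tilde N})$ when the integral is finite. 3. For every real $\varepsilon>0$, $$R_{\tilde N}\le\frac{2(N+1)}{\varepsilon(1+\tilde N)^{\varepsilon/2}}\Big(\int_X\big(1+l+\log_p^+\|\chi\|\big)^{2+\varepsilon}|\hat f(\chi)|^2d\nu(\chi)\Big)^{1/2}.$$ -/

import Mathlib

open MeasureTheory Filter Topology
open scoped ENNReal

noncomputable section

/-- Two-sided sequences of residues mod `p` that vanish far to the left. -/
def vilenkinSubgroup (p : ℕ) : AddSubgroup (ℤ → ZMod p) where
  carrier := {x | ∃ k : ℤ, ∀ n < k, x n = 0}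
  zero_mem' := ⟨0, fun _ _ => rfl⟩
  add_mem' := by
    rintro x y ⟨k, hk⟩ ⟨l, hl⟩
    refine ⟨min k l, fun n hn => ?_⟩
    simp [hk n (lt_of_lt_of_le hn (min_le_left _ _)), hl n (lt_of_lt_of_le hn (min_le_right _ _))]
  neg_mem' := by
    rintro x ⟨k, hk⟩
    exact ⟨k, fun n hn => by simp [hk n hn]⟩

/-- The Vilenkin group `G`.  It is a `def`, so it does not inherit the product topology. -/
def Vilenkin (p : ℕ) : Type := vilenkinSubgroup p

namespace Vilenkin

instance (p : ℕ) : AddCommGroup (Vilenkin p) :=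
  inferInstanceAs (AddCommGroup (vilenkinSubgroup p))

variable {p : ℕ}

/-- The `n`-th coordinate `x_n`. -/
def coord (x : Vilenkin p) (n : ℤ) : ZMod p := x.1 n

@[ext] theorem ext {x y : Vilenkin p} (h : ∀ n, x.coord n = y.coord n) : x = y :=
  Subtype.ext (funext h)

@[simp] theorem coord_zero (n : ℤ) : (0 : Vilenkin p).coord n = 0 := rfl
@[simp] theorem coord_add (x y : Vilenkin p) (n : ℤ) :
    (x + y).coord n = x.coord n + y.coord n := rfl
@[simp] theorem coord_neg (x : Vilenkin p) (n : ℤ) : (-x).coord n = -x.coord n := rfl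

/-- The subgroup `G_n` of sequences with `x_k = 0` for all `k < n`. -/
def chain (p : ℕ) (n : ℤ) : AddSubgroup (Vilenkin p) where
  carrier := {x | ∀ k < n, x.coord k = 0}
  zero_mem' := fun _ _ => rfl
  add_mem' := fun hx hy k hk => by simp [hx k hk, hy k hk]
  neg_mem' := fun hx k hk => by simp [hx k hk]

theorem mem_chain {n : ℤ} {x : Vilenkin p} : x ∈ chain p n ↔ ∀ k < n, x.coord k = 0 := Iff.rfl

theorem chain_antitone {m n : ℤ} (h : m ≤ n) : chain p n ≤ chain p m :=
  fun _ hx k hk => hx k (lt_of_lt_of_le hk h)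

/-- The topology of `G`: the cosets of the subgroups `G_n` form a base. -/
instance : TopologicalSpace (Vilenkin p) where
  IsOpen U := ∀ x ∈ U, ∃ n : ℤ, ∀ g ∈ chain p n, x + g ∈ U
  isOpen_univ := fun _ _ => ⟨0, fun _ _ => trivial⟩
  isOpen_inter := by
    rintro U V hU hV x ⟨hxU, hxV⟩
    obtain ⟨m, hm⟩ := hU x hxU
    obtain ⟨n, hn⟩ := hV x hxV
    exact ⟨max m n, fun g hg => ⟨hm g (chain_antitone (le_max_left _ _) hg),
      hn g (chain_antitone (le_max_right _ _) hg)⟩⟩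
  isOpen_sUnion := by
    rintro S hS x ⟨U, hU, hxU⟩
    obtain ⟨n, hn⟩ := hS U hU x hxU
    exact ⟨n, fun g hg => ⟨U, hU, hn g hg⟩⟩

theorem isOpen_iff {U : Set (Vilenkin p)} :
    IsOpen U ↔ ∀ x ∈ U, ∃ n : ℤ, ∀ g ∈ chain p n, x + g ∈ U := Iff.rfl

instance : MeasurableSpace (Vilenkin p) := borel _

instance : BorelSpace (Vilenkin p) := ⟨rfl⟩

/-- The power `𝒜 ^ j` of the dilation operator `𝒜`, where `(𝒜 x)_n = x_{n+1}`,
i.e. `𝒜 (∑ a_n g_n) = ∑ a_n g_{n-1}`. -/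
def dilate (j : ℤ) : Vilenkin p →+ Vilenkin p where
  toFun x := ⟨fun n => x.coord (n + j), by
    obtain ⟨k, hk⟩ := x.2
    exact ⟨k - j, fun n hn => hk (n + j) (by omega)⟩⟩
  map_zero' := rfl
  map_add' _ _ := rfl

@[simp] theorem coord_dilate (j : ℤ) (x : Vilenkin p) (n : ℤ) :
    (dilate j x).coord n = x.coord (n + j) := rfl

theorem continuous_dilate (j : ℤ) : Continuous (dilate j : Vilenkin p → Vilenkin p) := by
  refine continuous_def.2 fun U hU x hx => ?_
  obtain ⟨n, hn⟩ := hU _ hx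
  refine ⟨n + j, fun g hg => ?_⟩
  have h : dilate j g ∈ chain p n := fun k hk => hg (k + j) (by omega)
  simpa [map_add] using hn _ h

/-- `H₀`: the finite sums `a_{-1} g_{-1} + ... + a_{-s} g_{-s}`. -/
def H0 (p : ℕ) : Set (Vilenkin p) := {h | ∀ n ≥ 0, h.coord n = 0}

/-- The group `X` of (continuous) characters of `G`; the group law is multiplication. -/
abbrev Chars (p : ℕ) : Type := PontryaginDual (Multiplicative (Vilenkin p))

instance : MeasurableSpace (Chars p) := borel _

instance : BorelSpace (Chars p) := ⟨rfl⟩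

/-- The value `(χ, x)`. -/
def ev (χ : Chars p) (x : Vilenkin p) : ℂ := (χ (Multiplicative.ofAdd x) : Circle)

/-- The annihilator `G_n^⊥`. -/
def annih (p : ℕ) (n : ℤ) : Subgroup (Chars p) where
  carrier := {χ | ∀ x ∈ chain p n, χ (Multiplicative.ofAdd x) = 1}
  one_mem' := fun _ _ => rfl
  mul_mem' := by
    intro χ η hχ hη x hx
    have h : (χ * η) (Multiplicative.ofAdd x)
      = χ (Multiplicative.ofAdd x) * η (Multiplicative.ofAdd x) := rfl
    rw [h, hχ x hx, hη x hx, one_mul]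
  inv_mem' := by
    intro χ hχ x hx
    have h : (χ⁻¹) (Multiplicative.ofAdd x) = (χ (Multiplicative.ofAdd x))⁻¹ := rfl
    rw [h, hχ x hx, inv_one]

theorem annih_mono {m n : ℤ} (h : m ≤ n) : annih p m ≤ annih p n :=
  fun _ hχ x hx => hχ x (chain_antitone h hx)

/-- The character `χ 𝒜^j`, i.e. `x ↦ (χ, 𝒜^j x)`. -/
def dualDilate (j : ℤ) (χ : Chars p) : Chars p :=
  PontryaginDual.map
    (⟨AddMonoidHom.toMultiplicative (dilate j), continuous_dilate j⟩ :
      Multiplicative (Vilenkin p) →ₜ* Multiplicative (Vilenkin p)) χ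

theorem ev_dualDilate (j : ℤ) (χ : Chars p) (x : Vilenkin p) :
    ev (dualDilate j χ) x = ev χ (dilate j x) := rfl

/-- The level of a character `χ ≠ 1`: the integer `n` with `χ ∈ G_n^⊥ \ G_{n-1}^⊥`. -/
def level (χ : Chars p) : ℤ := sInf {n : ℤ | χ ∈ annih p n}

theorem level_eq {χ : Chars p} {n : ℤ} (h : χ ∈ annih p n) (h' : χ ∉ annih p (n - 1)) :
    level χ = n := by
  have hs : {k : ℤ | χ ∈ annih p k} = Set.Ici n := by
    ext k
    refine ⟨fun hk => ?_, fun hk => annih_mono hk h⟩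
    by_contra hlt
    have hlt' : k < n := not_le.1 hlt
    exact h' (annih_mono (by omega) hk)
  rw [level, hs, csInf_Ici]

open scoped Classical in
/-- `‖χ‖ = p ^ n` for `χ ∈ G_n^⊥ \ G_{n-1}^⊥`, and `‖1‖ = 0`. -/
def charNorm (χ : Chars p) : ℝ := if χ = 1 then 0 else (p : ℝ) ^ level χ

/-- The step function with value `γ n` on `G_n^⊥ \ G_{n-1}^⊥`
(its value at the single point `χ = 1`, a null set, is immaterial). -/
def stepWeight (γ : ℤ → ℝ) (χ : Chars p) : ℝ := γ (level χ)

/-- `log_p^+ ‖χ‖`, equal to `log_p ‖χ‖` if `‖χ‖ > 1` and to `1` if `‖χ‖ ≤ 1`. -/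
def logPlus (χ : Chars p) : ℝ := if 1 < charNorm χ then Real.logb p (charNorm χ) else 1

/-- The (absolutely convergent) Fourier integral of `f` over the set `S`. -/
def fourierOn (μ : Measure (Vilenkin p)) (S : Set (Vilenkin p)) (f : Vilenkin p → ℂ)
    (χ : Chars p) : ℂ :=
  ∫ x in S, f x * (starRingEnd ℂ) (ev χ x) ∂μ

/-- `F` is the Fourier transform of `f ∈ L₂(G)`: the limit in the norm of `L₂(X)`, as
`n → +∞`, of the Fourier integrals over the subgroups `G_{-n}`. -/
def IsL2Fourier (μ : Measure (Vilenkin p)) (ν : Measure (Chars p))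
    (f : Vilenkin p → ℂ) (F : Chars p → ℂ) : Prop :=
  MemLp F 2 ν ∧
    Tendsto (fun n : ℕ =>
      eLpNorm (fun χ => F χ - fourierOn μ (chain p (-(n : ℤ)) : Set (Vilenkin p)) f χ) 2 ν)
      atTop (𝓝 0)

/-- The inner product `⟨f, g⟩` of `L₂(G)`. -/
def inner2 (μ : Measure (Vilenkin p)) (f g : Vilenkin p → ℂ) : ℂ :=
  ∫ x, f x * (starRingEnd ℂ) (g x) ∂μ

/-- `s` is the sum in `L₂(G)` of the unconditionally convergent series `∑ i, u i`. -/
def HasL2Sum {ι : Type} (μ : Measure (Vilenkin p)) (u : ι → Vilenkin p → ℂ)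
    (s : Vilenkin p → ℂ) : Prop :=
  (∀ i, MemLp (u i) 2 μ) ∧ MemLp s 2 μ ∧
    Tendsto (fun A : Finset ι => eLpNorm (fun x => s x - ∑ i ∈ A, u i x) 2 μ) atTop (𝓝 0)

/-- The class `𝔇_{G_M}(G_{-N})` of functions supported in `G_{-N}` and constant on the
cosets of `G_M`. -/
def StepClass (M N : ℕ) (φ : Vilenkin p → ℂ) : Prop :=
  (∀ x, x ∉ chain p (-(N : ℤ)) → φ x = 0) ∧ ∀ x, ∀ g ∈ chain p (M : ℤ), φ (x + g) = φ x

/-- The refinement equation `φ(x) = p ∑_{h ∈ H₀} β_h φ(𝒜 x - h)` with `(β_h) ∈ ℓ²`.  For a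
step function of compact support only finitely many terms are non-zero at each `x`. -/
def IsRefinable (φ : Vilenkin p → ℂ) : Prop :=
  ∃ β : H0 p → ℂ, Summable (fun h => ‖β h‖ ^ 2) ∧
    ∀ x, φ x = p * ∑ᶠ h : H0 p, β h * φ (dilate 1 x - h.1)

/-- `ψ_{n,h}(x) = p^{n/2} ψ(𝒜^n x - h)`. -/
def wavelet (ψ : Vilenkin p → ℂ) (n : ℤ) (h : Vilenkin p) (x : Vilenkin p) : ℂ :=
  (((p : ℝ) ^ ((n : ℝ) / 2) : ℝ) : ℂ) * ψ (dilate n x - h)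

/-- The step wavelet systems under consideration: `φ ∈ 𝔇_{G_M}(G_{-N})` is refinable, the masks
`m j` satisfy `φ̂(χ 𝒜⁻¹) m_j(χ) = 1_{E_j}(χ)` for pairwise disjoint cosets `E_j` of subgroups
`G_{-s(j)}^⊥`, `s(j) ≥ 0`, the sets `E_j 𝒜^{t(j)}` partition `G_{M+1}^⊥ \ G_M^⊥`, and `ψ_j` is
defined by `ψ̂_j(χ) = φ̂(χ 𝒜⁻¹) m_j(χ)`.  No periodicity of the masks is required. -/
structure IsStepWaveletSystem (μ : Measure (Vilenkin p)) (ν : Measure (Chars p))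
    (M N q : ℕ) (φ : Vilenkin p → ℂ) (m : Fin q → Chars p → ℂ) (E : Fin q → Set (Chars p))
    (t : Fin q → ℕ) (ψ : Fin q → Vilenkin p → ℂ) : Prop where
  step : StepClass M N φ
  refinable : IsRefinable φ
  coset : ∀ j, ∃ (s : ℕ) (χ₀ : Chars p), E j = {χ | χ * χ₀⁻¹ ∈ annih p (-(s : ℤ))}
  disjoint : Pairwise fun i j => Disjoint (E i) (E j)
  mask : ∀ j, ∀ᵐ χ ∂ν,
    fourierOn μ Set.univ φ (dualDilate (-1) χ) * m j χ = (E j).indicator (fun _ => 1) χ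
  disjoint_dilated : Pairwise fun i j =>
    Disjoint (dualDilate (t i : ℤ) '' E i) (dualDilate (t j : ℤ) '' E j)
  iUnion_dilated : ⋃ j, dualDilate (t j : ℤ) '' E j
    = (annih p ((M : ℤ) + 1) : Set (Chars p)) \ (annih p (M : ℤ) : Set (Chars p))
  wavelet_memLp : ∀ j, MemLp (ψ j) 2 μ
  wavelet_fourier : ∀ j,
    IsL2Fourier μ ν (ψ j) fun χ => fourierOn μ Set.univ φ (dualDilate (-1) χ) * m j χ

/-- `S` is the partial sum `∑_{n ≤ Ñ} ∑_j ∑_{h ∈ H₀} ⟨f, ψ^{(j)}_{n,h}⟩ ψ^{(j)}_{n,h}`. -/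
def IsPartialSum (μ : Measure (Vilenkin p)) {q : ℕ} (ψ : Fin q → Vilenkin p → ℂ)
    (f : Vilenkin p → ℂ) (K : ℤ) (S : Vilenkin p → ℂ) : Prop :=
  HasL2Sum μ
    (fun (i : {n : ℤ // n ≤ K} × Fin q × H0 p) x =>
      inner2 μ f (wavelet (ψ i.2.1) i.1 i.2.2) * wavelet (ψ i.2.1) i.1 i.2.2 x) S

/-- The weighted norm `(∫_X w(χ)² |F(χ)|² dν(χ))^{1/2}`, with values in `[0, ∞]`. -/
def weightedNorm (ν : Measure (Chars p)) (w : Chars p → ℝ) (F : Chars p → ℂ) : ℝ≥0∞ :=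
  (∫⁻ χ, ENNReal.ofReal (w χ ^ 2 * ‖F χ‖ ^ 2) ∂ν) ^ (1 / 2 : ℝ)

end Vilenkin

end

noncomputable section

/-! ### Topology of `G`: balls, compactness of the subgroups, countability, dilations. -/

namespace Vilenkin

variable {p : ℕ}

/-! The whole estimate takes place on the frequency side, where the partial sum is a sharp cut-off.
Since the transform of `ψ j` is the indicator of the coset `E j`, the transform of `ψ_{n,h}` is a
scaled character indexed by `h` on the set `E j 𝒜^n`. As `h` runs over `H₀` these characters form a
Parseval system on that set, because `E j` lies in a single coset of `G_0^⊥`. So the squared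
coefficients of `f` with fixed `n` and `j` add up to the integral of `|f̂|²` over `E j 𝒜^n`.

The sets `E j 𝒜^n` are pairwise disjoint for distinct pairs `(n, j)`: after a dilation by `t j` each
`E j` lies in the shell of level `M + 1`, and these pieces tile the shell. Hence for `n ≤ K` the
system is a Parseval frame for the functions with spectrum in the union `D` of these sets. The
series converges unconditionally, and the error is exactly the norm of `f̂` outside `D`
(`exists_isPartialSum`, resting on `hasSum_inner_smul_of_parseval` and `tsum_inner_waveletFourier`).

A nontrivial character of level `L` outside `D` satisfies `L + l ≥ K + M + 2`
(`le_level_of_forall_not_mem`). There each weight, multiplied by its constant, is at least one, so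
all the bounds follow from one pointwise comparison (`eLpNorm_indicator_le_weightedNorm`). The
factors `N + 1` and `p^{M/2}` enter only through being at least one.

The harmonic analysis is built by hand. The residue pairing `∑ y_k x_{-1-k}` identifies `G` with its
dual and carries `𝒜` to its dual dilation, so everything on `X` is read on `G`. Plancherel on `G_0`
amounts to completeness of the characters; dilation transfers it to every `G_n`, and the `L₂`
transform is the limit along `G_{-n}`. -/

@[simp] theorem coord_sub (x y : Vilenkin p) (n : ℤ) :
    (x - y).coord n = x.coord n - y.coord n := by
  simp [sub_eq_add_neg]

theorem nhds_hasBasis (x : Vilenkin p) :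
    (𝓝 x).HasBasis (fun _ : ℤ => True) fun n => {y | y - x ∈ chain p n} := by
  refine ⟨fun U => ⟨fun hU => ?_, ?_⟩⟩
  · obtain ⟨V, hVU, hV, hx⟩ := mem_nhds_iff.1 hU
    obtain ⟨n, hn⟩ := isOpen_iff.1 hV x hx
    exact ⟨n, trivial, fun y hy => hVU (by simpa using hn _ hy)⟩
  · rintro ⟨n, -, hn⟩
    refine mem_nhds_iff.2 ⟨_, hn, isOpen_iff.2 fun y hy => ⟨n, fun g hg => ?_⟩, ?_⟩
    · have : y + g - x = (y - x) + g := by abel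
      simpa [this] using (chain p n).add_mem hy hg
    · simp

instance : IsTopologicalAddGroup (Vilenkin p) where
  continuous_add := by
    refine continuous_iff_continuousAt.2 fun ⟨x, y⟩ => ?_
    rw [ContinuousAt, nhds_prod_eq,
      ((nhds_hasBasis x).prod (nhds_hasBasis y)).tendsto_iff (nhds_hasBasis (x + y))]
    refine fun n _ => ⟨(n, n), ⟨trivial, trivial⟩, ?_⟩
    rintro ⟨a, b⟩ ⟨ha, hb⟩
    have : a + b - (x + y) = (a - x) + (b - y) := by abel
    simpa [this] using (chain p n).add_mem ha hb
  continuous_neg := by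
    refine continuous_iff_continuousAt.2 fun x => ?_
    rw [ContinuousAt, (nhds_hasBasis x).tendsto_iff (nhds_hasBasis (-x))]
    refine fun n _ => ⟨n, trivial, fun a ha => ?_⟩
    have : -a - -x = -(a - x) := by abel
    change -a - -x ∈ chain p n
    exact this ▸ (chain p n).neg_mem ha

theorem isOpen_chain (n : ℤ) : IsOpen (chain p n : Set (Vilenkin p)) :=
  isOpen_iff.2 fun _ hx => ⟨n, fun _ hg => (chain p n).add_mem hx hg⟩

theorem measurableSet_chain (n : ℤ) : MeasurableSet (chain p n : Set (Vilenkin p)) :=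
  (isOpen_chain n).measurableSet

/-- The coset of `G_n` containing `x`. -/
def ball (x : Vilenkin p) (n : ℤ) : Set (Vilenkin p) := {y | y - x ∈ chain p n}

theorem mem_ball {x y : Vilenkin p} {n : ℤ} : y ∈ ball x n ↔ y - x ∈ chain p n := Iff.rfl

theorem ball_eq_preimage (x : Vilenkin p) (n : ℤ) :
    ball x n = (fun y => y - x) ⁻¹' (chain p n : Set (Vilenkin p)) := rfl

theorem isOpen_ball (x : Vilenkin p) (n : ℤ) : IsOpen (ball x n) :=
  (isOpen_chain n).preimage (continuous_id.sub continuous_const)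

theorem measurableSet_ball (x : Vilenkin p) (n : ℤ) : MeasurableSet (ball x n) :=
  (isOpen_ball x n).measurableSet

theorem ball_subset_ball {x y z : Vilenkin p} {m n : ℤ} (h : m ≤ n)
    (hm : z ∈ ball x m) (hn : z ∈ ball y n) : ball y n ⊆ ball x m := by
  intro w hw
  have : w - x = (w - y) - (z - y) + (z - x) := by abel
  rw [mem_ball, this]
  exact (chain p m).add_mem ((chain p m).sub_mem (chain_antitone h hw) (chain_antitone h hn)) hm

theorem exists_mem_chain (x : Vilenkin p) : ∃ n : ℕ, x ∈ chain p (-(n : ℤ)) := by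
  obtain ⟨k, hk⟩ := x.2
  exact ⟨k.natAbs, fun j hj => hk j (by omega)⟩

theorem eq_zero_of_forall_mem_chain {x : Vilenkin p} (h : ∀ n : ℕ, x ∈ chain p n) : x = 0 := by
  ext n
  exact h (n.natAbs + 1) n (by omega)

instance : T2Space (Vilenkin p) := by
  refine IsTopologicalAddGroup.t2Space_of_zero_sep fun x hx => ?_
  by_contra! h
  refine hx (eq_zero_of_forall_mem_chain fun n => ?_)
  exact h _ ((isOpen_chain n).mem_nhds (chain p (n : ℤ)).zero_mem)

/-- The sequence with values `a k` for `m ≤ k` and zero elsewhere. -/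
def extendFrom (m : ℤ) (a : ℤ → ZMod p) : Vilenkin p :=
  ⟨fun k => if m ≤ k then a k else 0, m, fun k hk => by simp [not_le.2 hk]⟩

theorem coord_extendFrom (m : ℤ) (a : ℤ → ZMod p) (k : ℤ) :
    (extendFrom m a).coord k = if m ≤ k then a k else 0 := rfl

theorem continuous_extendFrom [NeZero p] (m : ℤ) :
    Continuous (extendFrom m : (ℤ → ZMod p) → Vilenkin p) := by
  refine continuous_iff_continuousAt.2 fun a => (nhds_hasBasis _).tendsto_right_iff.2 fun n _ => ?_
  have h : ∀ᶠ b : ℤ → ZMod p in 𝓝 a, ∀ k ∈ Finset.Ico m n, b k = a k := by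
    rw [Filter.eventually_all_finset]
    intro k _
    exact (continuous_apply k).continuousAt.eventually
      ((isOpen_discrete {a k}).mem_nhds rfl)
  filter_upwards [h] with b hb k hk
  rw [coord_sub, coord_extendFrom, coord_extendFrom]
  split_ifs with h
  · rw [hb k (Finset.mem_Ico.2 ⟨h, hk⟩), sub_self]
  · simp

/-- Tychonoff: `G_n` is a continuous image of the product of copies of the finite set `ZMod p`. -/
theorem isCompact_chain [NeZero p] (n : ℤ) : IsCompact (chain p n : Set (Vilenkin p)) := by
  have h : (chain p n : Set (Vilenkin p)) = Set.range (extendFrom n) := by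
    ext x
    refine ⟨fun hx => ⟨fun k => x.coord k, ?_⟩, ?_⟩
    · ext k
      rw [coord_extendFrom]
      split_ifs with h
      · rfl
      · exact (hx k (not_le.1 h)).symm
    · rintro ⟨a, rfl⟩ k hk
      simp [coord_extendFrom, not_le.2 hk]
  rw [h]
  exact isCompact_range (continuous_extendFrom n)

instance [NeZero p] : LocallyCompactSpace (Vilenkin p) :=
  (isCompact_chain 0).locallyCompactSpace_of_mem_nhds_of_addGroup
    ((isOpen_chain (p := p) 0).mem_nhds (chain p 0).zero_mem)

/-- The finitely supported sequences. -/
def finitary (p : ℕ) : Set (Vilenkin p) := {x | ∃ k, ∀ n ≥ k, x.coord n = 0}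

theorem finite_support_of_finitary {x : Vilenkin p} (h : x ∈ finitary p) :
    (Function.support x.coord).Finite := by
  obtain ⟨k, hk⟩ := h
  obtain ⟨m, hm⟩ := exists_mem_chain x
  refine (Set.finite_Ico (-(m : ℤ)) k).subset fun n hn => ⟨?_, ?_⟩
  · by_contra h
    exact hn (hm n (not_le.1 h))
  · by_contra h
    exact hn (hk n (not_lt.1 h))

theorem countable_finitary [NeZero p] : (finitary p).Countable := by
  have : Function.Injective fun x : finitary p =>
      Finsupp.ofSupportFinite x.1.coord (finite_support_of_finitary x.2) := by
    intro x y h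
    ext n
    exact DFunLike.congr_fun h n
  exact Set.countable_coe_iff.1 this.countable

theorem H0_subset_finitary : H0 p ⊆ finitary p := fun _ hx => ⟨0, hx⟩

instance [NeZero p] : Countable (H0 p) :=
  (countable_finitary.mono H0_subset_finitary).to_subtype

/-- Truncating the centre of a ball to its finitely many relevant coordinates does not change the
ball, so countably many centres suffice. The same family later serves as a π-system generating the
Borel sets. -/
theorem isTopologicalBasis_ball :
    TopologicalSpace.IsTopologicalBasis
      (Set.range fun i : finitary p × ℤ => ball i.1.1 i.2) := by
  refine TopologicalSpace.isTopologicalBasis_of_isOpen_of_nhds ?_ fun x U hx hU => ?_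
  · rintro _ ⟨i, rfl⟩
    exact isOpen_ball _ _
  · obtain ⟨n, -, hn⟩ := (nhds_hasBasis x).mem_iff.1 (hU.mem_nhds hx)
    obtain ⟨m, hm⟩ := exists_mem_chain x
    let y : Vilenkin p := ⟨fun k => if k < n then x.coord k else 0, -(m : ℤ), fun k hk => by
      simp [hm k hk]⟩
    have hy : ∀ k, y.coord k = if k < n then x.coord k else 0 := fun _ => rfl
    have hxy : x ∈ ball y n := fun k hk => by simp [hy, hk]
    refine ⟨_, ⟨(⟨y, n, fun k hk => by simp [hy, not_lt.2 hk]⟩, n), rfl⟩, hxy, ?_⟩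
    refine (ball_subset_ball le_rfl ?_ hxy).trans hn
    simp [mem_ball]

instance [NeZero p] : SecondCountableTopology (Vilenkin p) := by
  have := (countable_finitary (p := p)).to_subtype
  exact isTopologicalBasis_ball.secondCountableTopology (Set.countable_range _)

theorem dilate_mem_chain {j n : ℤ} {x : Vilenkin p} :
    dilate j x ∈ chain p n ↔ x ∈ chain p (n + j) := by
  refine ⟨fun h k hk => ?_, fun h k hk => h _ (by omega)⟩
  simpa using h (k - j) (by omega)

@[simp] theorem dilate_zero (x : Vilenkin p) : dilate 0 x = x := by ext; simp

theorem dilate_dilate (i j : ℤ) (x : Vilenkin p) : dilate i (dilate j x) = dilate (i + j) x := by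
  ext; simp [add_assoc]

/-- Dilation as a homeomorphism. -/
def dilateHomeomorph (j : ℤ) : Vilenkin p ≃ₜ Vilenkin p where
  toFun := dilate j
  invFun := dilate (-j)
  left_inv x := by simp [dilate_dilate]
  right_inv x := by simp [dilate_dilate]
  continuous_toFun := continuous_dilate j
  continuous_invFun := continuous_dilate (-j)

theorem measurableEmbedding_dilate (j : ℤ) :
    MeasurableEmbedding (dilate j : Vilenkin p → Vilenkin p) :=
  (dilateHomeomorph j).measurableEmbedding

/-- Together with `eq_of_sub_mem_chain_zero` this makes `H₀` a system of representatives for `G /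
G_0`. -/
theorem exists_H0_sub_mem (x : Vilenkin p) : ∃ h ∈ H0 p, x - h ∈ chain p 0 := by
  obtain ⟨m, hm⟩ := exists_mem_chain x
  let y : Vilenkin p := ⟨fun k => if k < 0 then x.coord k else 0, -(m : ℤ), fun k hk => by
    simp [hm k hk]⟩
  have hy : ∀ k, y.coord k = if k < 0 then x.coord k else 0 := fun _ => rfl
  exact ⟨y, fun k hk => by simp [hy, hk], fun k hk => by simp [hy, hk]⟩

theorem eq_of_sub_mem_chain_zero {h h' : Vilenkin p} (hh : h ∈ H0 p) (hh' : h' ∈ H0 p)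
    (hs : h - h' ∈ chain p 0) : h = h' := by
  ext k
  rcases lt_or_ge k 0 with hk | hk
  · exact sub_eq_zero.1 (by simpa using hs k hk)
  · rw [hh k hk, hh' k hk]

end Vilenkin

/-! ### Self-duality of `G` through the residue pairing. -/

namespace Vilenkin

variable {p : ℕ}

theorem hasFiniteSupport_mul_coord (y x : Vilenkin p) :
    (Function.support fun k : ℤ => y.coord k * x.coord (-1 - k)).Finite := by
  obtain ⟨m, hm⟩ := exists_mem_chain x
  obtain ⟨n, hn⟩ := exists_mem_chain y
  refine (Set.finite_Icc (-(n : ℤ)) m).subset fun k hk => ⟨?_, ?_⟩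
  · by_contra h
    exact hk (by simp [hn k (not_le.1 h)])
  · by_contra h
    exact hk (by simp [hm (-1 - k) (by omega)])

/-- The residue pairing `∑ y_k x_{-1-k}`. -/
def residue (y x : Vilenkin p) : ZMod p := ∑ᶠ k : ℤ, y.coord k * x.coord (-1 - k)

theorem residue_comm (y x : Vilenkin p) : residue y x = residue x y := by
  unfold residue
  rw [← finsum_comp_equiv (Equiv.subLeft (-1 : ℤ))]
  refine finsum_congr fun k => ?_
  simp [mul_comm]

theorem residue_add_right (y x x' : Vilenkin p) :
    residue y (x + x') = residue y x + residue y x' := by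
  unfold residue
  rw [← finsum_add_distrib (hasFiniteSupport_mul_coord y x) (hasFiniteSupport_mul_coord y x')]
  exact finsum_congr fun k => by simp [mul_add]

theorem residue_dilate (j : ℤ) (y x : Vilenkin p) :
    residue (dilate j y) x = residue y (dilate j x) := by
  unfold residue
  rw [← finsum_comp_equiv (Equiv.subRight j)]
  refine finsum_congr fun k => ?_
  simp only [Equiv.subRight_apply, coord_dilate, sub_add_cancel]
  congr 2
  ring

/-- The index `-1 - k` makes the two vanishing ranges complementary: `k < -n` kills the first factor
and `k ≥ -n` the second. This is why `G_n^⊥` corresponds exactly to `G_{-n}`, with no shift. -/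
theorem residue_eq_zero {n : ℤ} {y x : Vilenkin p} (hy : y ∈ chain p (-n)) (hx : x ∈ chain p n) :
    residue y x = 0 := by
  rw [residue, ← finsum_zero (α := ℤ)]
  refine finsum_congr fun k => ?_
  rcases lt_or_ge k (-n) with h | h
  · simp [hy k h]
  · simp [hx (-1 - k) (by omega)]

/-- The sequence with the single non-zero entry `a` in position `k`. -/
def single (k : ℤ) (a : ZMod p) : Vilenkin p :=
  ⟨fun i => if i = k then a else 0, k, fun i hi => by simp [hi.ne]⟩

theorem coord_single (k : ℤ) (a : ZMod p) (i : ℤ) :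
    (single k a).coord i = if i = k then a else 0 := rfl

theorem residue_single (y : Vilenkin p) (k : ℤ) (a : ZMod p) :
    residue y (single k a) = y.coord (-1 - k) * a := by
  rw [residue, finsum_eq_single _ (-1 - k)]
  · simp [coord_single]
  · intro i hi
    simp [coord_single, show -1 - i ≠ k by omega]

theorem single_add (k : ℤ) (a b : ZMod p) : single k (a + b) = single k a + single k b := by
  ext i
  simp only [coord_add, coord_single]
  split_ifs <;> simp

theorem residue_zero_right (y : Vilenkin p) : residue y 0 = 0 := by simp [residue]

theorem residue_add_left (y y' x : Vilenkin p) :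
    residue (y + y') x = residue y x + residue y' x := by
  simp only [residue_comm _ x, residue_add_right]

/-- The circle has no small subgroups: a subgroup `G_n` mapped into a short arc must be mapped to
`1`. -/
theorem exists_mem_annih (χ : Chars p) : ∃ n : ℕ, χ ∈ annih p n := by
  have h : ∀ᶠ x : Vilenkin p in 𝓝 0,
      χ (Multiplicative.ofAdd x) ∈ Circle.centeredArc (Real.pi / 2) := by
    have hc : Continuous fun x : Vilenkin p => χ (Multiplicative.ofAdd x) := map_continuous χ
    refine hc.continuousAt.eventually ((Circle.isOpen_centeredArc _).mem_nhds ?_)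
    have : χ (Multiplicative.ofAdd 0) = 1 := map_one χ
    change χ (Multiplicative.ofAdd 0) ∈ _
    rw [this, Circle.mem_centeredArc (by linarith [Real.pi_pos])]
    simp [Real.pi_pos]
  obtain ⟨n, -, hn⟩ := (nhds_hasBasis 0).mem_iff.1 h
  refine ⟨n.natAbs, fun x hx => ?_⟩
  refine Circle.eq_one_of_forall_pow_mem_centeredArc_pi_div_two fun k _ => ?_
  rw [← map_pow]
  refine hn (a := k • x) ?_
  simpa using chain_antitone (by omega) ((chain p _).nsmul_mem hx k)

variable [NeZero p]

theorem continuous_toCircle_residue :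
    Continuous fun z : Vilenkin p × Vilenkin p => ZMod.toCircle (residue z.1 z.2) := by
  refine continuous_iff_continuousAt.2 fun ⟨y, x⟩ => ?_
  obtain ⟨m, hm⟩ := exists_mem_chain x
  obtain ⟨n, hn⟩ := exists_mem_chain y
  have h : ∀ᶠ z : Vilenkin p × Vilenkin p in 𝓝 (y, x),
      ZMod.toCircle (residue y x) = ZMod.toCircle (residue z.1 z.2) := by
    have h1 : ∀ᶠ z : Vilenkin p × Vilenkin p in 𝓝 (y, x), z.1 ∈ ball y (max m (-n)) :=
      continuous_fst.continuousAt.eventually ((isOpen_ball y _).mem_nhds (by simp [mem_ball]))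
    have h2 : ∀ᶠ z : Vilenkin p × Vilenkin p in 𝓝 (y, x), z.2 ∈ ball x (max n (-m)) :=
      continuous_snd.continuousAt.eventually ((isOpen_ball x _).mem_nhds (by simp [mem_ball]))
    filter_upwards [h1, h2] with z h1 h2
    have e1 : residue y (z.2 - x) = 0 :=
      residue_eq_zero hn (chain_antitone (le_max_left _ _) h2)
    have hz2 : z.2 ∈ chain p (-(m : ℤ)) := by
      have : z.2 = (z.2 - x) + x := by abel
      rw [this]
      exact (chain p _).add_mem (chain_antitone (le_max_right _ _) h2) hm
    have e2 : residue (z.1 - y) z.2 = 0 := by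
      refine residue_eq_zero (n := -(m : ℤ)) ?_ hz2
      rw [neg_neg]
      exact chain_antitone (le_max_left _ _) h1
    -- Both increments lie in subgroups orthogonal to the other argument, so the pairing is locally
    -- constant jointly in its two variables.
    have : residue z.1 z.2 = residue (z.1 - y) z.2 + (residue y (z.2 - x) + residue y x) := by
      rw [← residue_add_right, sub_add_cancel, ← residue_add_left, sub_add_cancel]
    rw [this, e1, e2, zero_add, zero_add]
  exact continuousAt_const.congr h

theorem continuous_toCircle_residue_right (y : Vilenkin p) :
    Continuous fun x : Vilenkin p => ZMod.toCircle (residue y x) :=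
  Continuous.comp (f := fun x : Vilenkin p => (y, x)) continuous_toCircle_residue
    (continuous_const.prodMk continuous_id)

/-- The homomorphism underlying `dual`. -/
def dualHom (y : Vilenkin p) : Multiplicative (Vilenkin p) →* Circle where
  toFun x := ZMod.toCircle (residue y x.toAdd)
  map_one' := by simp [residue_zero_right]
  map_mul' x x' := by rw [toAdd_mul, residue_add_right, AddChar.map_add_eq_mul]

/-- The character of `G` attached to `y ∈ G`. -/
def dual (y : Vilenkin p) : Chars p :=
  (⟨dualHom y, continuous_toCircle_residue_right y⟩ : Multiplicative (Vilenkin p) →ₜ* Circle)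

theorem dual_apply (y x : Vilenkin p) :
    dual y (Multiplicative.ofAdd x) = ZMod.toCircle (residue y x) := rfl

theorem dual_add (y y' : Vilenkin p) : dual (y + y') = dual y * dual y' := by
  refine PontryaginDual.ext fun x => ?_
  change ZMod.toCircle (residue (y + y') _) =
    ZMod.toCircle (residue y _) * ZMod.toCircle (residue y' _)
  rw [residue_add_left, AddChar.map_add_eq_mul]

theorem dual_zero : dual (0 : Vilenkin p) = 1 := by
  have h := dual_add (0 : Vilenkin p) 0
  rwa [add_zero, left_eq_mul] at h

theorem dual_sub (y y' : Vilenkin p) : dual (y - y') = dual y * (dual y')⁻¹ := by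
  rw [eq_mul_inv_iff_mul_eq, ← dual_add, sub_add_cancel]

theorem dual_dilate (j : ℤ) (y : Vilenkin p) : dual (dilate j y) = dualDilate j (dual y) :=
  PontryaginDual.ext fun x => congrArg ZMod.toCircle (residue_dilate j y x.toAdd)

theorem continuous_dual : Continuous (dual : Vilenkin p → Chars p) :=
  ContinuousMonoidHom.continuous_of_continuous_uncurry
    (A := Vilenkin p) (B := Multiplicative (Vilenkin p)) (C := Circle) dual
    continuous_toCircle_residue

theorem dual_mem_annih {n : ℤ} {y : Vilenkin p} : dual y ∈ annih p n ↔ y ∈ chain p (-n) := by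
  refine ⟨fun h k hk => ?_, fun h x hx => ?_⟩
  · have := h (single (-1 - k) 1) fun i hi => by
      simp [coord_single, show i ≠ -1 - k by omega]
    rw [dual_apply, residue_single, mul_one, sub_sub_cancel, ← AddChar.map_zero_eq_one
      (ZMod.toCircle (N := p))] at this
    exact ZMod.injective_toCircle this
  · rw [dual_apply, residue_eq_zero h hx, AddChar.map_zero_eq_one]

theorem dual_injective : Function.Injective (dual : Vilenkin p → Chars p) := by
  intro y y' h
  rw [← sub_eq_zero]
  refine eq_zero_of_forall_mem_chain fun n => ?_
  rw [← neg_neg (n : ℤ), ← dual_mem_annih, dual_sub, h, mul_inv_cancel]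
  exact (annih p _).one_mem

/-- Sending the compact subgroup `G_n` into a short arc is a compact-open condition, and for a
subgroup it already forces triviality. -/
theorem isOpen_annih (n : ℤ) : IsOpen (annih p n : Set (Chars p)) := by
  let S : Set (Multiplicative (Vilenkin p)) := Multiplicative.toAdd ⁻¹' (chain p n)
  have hS : IsCompact S := isCompact_chain n
  let V : Set (Chars p) := {ψ | Set.MapsTo ψ S (Circle.centeredArc (Real.pi / 2))}
  have hV : IsOpen V :=
    isOpen_induced (ContinuousMap.isOpen_setOfPred_mapsTo hS
      (Circle.isOpen_centeredArc (Real.pi / 2)))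
  have : (annih p n : Set (Chars p)) = V := by
    ext ψ
    refine ⟨fun h x hx => ?_, fun h x hx => ?_⟩
    · have : ψ x = 1 := h x.toAdd hx
      rw [this, Circle.mem_centeredArc (by linarith [Real.pi_pos])]
      simp [Real.pi_pos]
    · refine Circle.eq_one_of_forall_pow_mem_centeredArc_pi_div_two fun k _ => ?_
      rw [← map_pow]
      exact h ((chain p n).nsmul_mem hx k)
  rwa [this]

theorem exists_toCircle_mul_eq (c : AddChar (ZMod p) Circle) :
    ∃ b : ZMod p, ∀ a, c a = ZMod.toCircle (b * a) := by
  obtain ⟨b, hb⟩ := AddChar.zmodAddEquiv.surjective (AddChar.circleEquivComplex c)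
  rw [AddChar.zmodAddEquiv_apply, AddChar.circleEquivComplex.injective.eq_iff] at hb
  exact ⟨b, fun a => hb ▸ rfl⟩

/-- A character kills some `G_n`, and its values on sequences with a single entry prescribe the
coordinates of `y`. Agreement then spreads from `G_n` to `G_{n-j}`, one coordinate at a time. -/
theorem dual_surjective : Function.Surjective (dual : Vilenkin p → Chars p) := by
  intro χ
  obtain ⟨n, hn⟩ := exists_mem_annih χ
  have h : ∀ k : ℤ, ∃ b : ZMod p, ∀ a,
      χ (Multiplicative.ofAdd (single k a)) = ZMod.toCircle (b * a) := fun k => by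
    have h0 : χ (Multiplicative.ofAdd (single k 0)) = 1 := by
      have : single k (0 : ZMod p) = 0 := by ext; simp [coord_single]
      rw [this]
      exact map_one χ
    exact exists_toCircle_mul_eq
      { toFun := fun a => χ (Multiplicative.ofAdd (single k a))
        map_zero_eq_one' := h0
        map_add_eq_mul' := fun a b => by rw [single_add, ofAdd_add, map_mul] }
  choose b hb using h
  have hb0 : ∀ k ≥ (n : ℤ), b k = 0 := fun k hk => by
    have h1 := hb k 1
    have h2 : χ (Multiplicative.ofAdd (single k 1)) = 1 := hn _ fun i hi => by
      simp [coord_single, show i ≠ k by omega]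
    rw [h2, mul_one, ← AddChar.map_zero_eq_one (ZMod.toCircle (N := p))] at h1
    exact (ZMod.injective_toCircle h1).symm
  let y : Vilenkin p := ⟨fun k => b (-1 - k), -(n : ℤ), fun k hk => hb0 _ (by omega)⟩
  have hy : ∀ k, y.coord k = b (-1 - k) := fun _ => rfl
  have key : ∀ j : ℕ, ∀ x ∈ chain p ((n : ℤ) - j),
      χ (Multiplicative.ofAdd x) = ZMod.toCircle (residue y x) := by
    intro j
    induction j with
    | zero =>
      intro x hx
      rw [residue_eq_zero (n := n) (fun k hk => (hy k).trans (hb0 _ (by omega))) (by simpa using hx),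
        AddChar.map_zero_eq_one]
      exact hn x (by simpa using hx)
    | succ j ih =>
      intro x hx
      set k : ℤ := (n : ℤ) - (j + 1 : ℕ) with hk
      have hx' : x - single k (x.coord k) ∈ chain p ((n : ℤ) - j) := fun i hi => by
        rw [coord_sub, coord_single]
        split_ifs with h
        · rw [h, sub_self]
        · rw [hx i (by omega), sub_zero]
      have : x = single k (x.coord k) + (x - single k (x.coord k)) := by abel
      rw [this, ofAdd_add, map_mul, ih _ hx', hb, residue_add_right, AddChar.map_add_eq_mul,
        residue_single, hy, sub_sub_cancel]
  refine ⟨y, PontryaginDual.ext fun x => ?_⟩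
  obtain ⟨m, hm⟩ := exists_mem_chain x.toAdd
  exact (key (n + m) x.toAdd (chain_antitone (by push_cast; omega) hm)).symm

/-- `dual` as a bijection. -/
def dualEquiv : Vilenkin p ≃ Chars p := Equiv.ofBijective dual ⟨dual_injective, dual_surjective⟩

theorem dualEquiv_symm_dual (y : Vilenkin p) : dualEquiv.symm (dual y) = y :=
  dualEquiv.symm_apply_apply y

/-- The self-duality of the Vilenkin group. -/
def dualHomeomorph : Vilenkin p ≃ₜ Chars p where
  toEquiv := dualEquiv
  continuous_toFun := continuous_dual
  continuous_invFun := by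
    refine continuous_iff_continuousAt.2 fun χ => ?_
    obtain ⟨y, rfl⟩ := dual_surjective χ
    rw [ContinuousAt, (nhds_hasBasis _).tendsto_right_iff]
    intro n _
    have ho : IsOpen {χ : Chars p | χ * (dual y)⁻¹ ∈ annih p (-n)} :=
      (isOpen_annih (p := p) (-n)).preimage (continuous_mul_const (dual y)⁻¹)
    filter_upwards [ho.mem_nhds (by simp)] with χ hχ
    obtain ⟨z, rfl⟩ := dual_surjective χ
    change dualEquiv.symm (dual z) - dualEquiv.symm (dual y) ∈ chain p n
    rw [dualEquiv_symm_dual, dualEquiv_symm_dual]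
    rwa [← dual_sub, dual_mem_annih, neg_neg] at hχ

theorem measurableEmbedding_dual : MeasurableEmbedding (dual : Vilenkin p → Chars p) :=
  dualHomeomorph.measurableEmbedding

/-- Uniqueness of Haar measure: `ν` transported to `G` is translation invariant, and the two
normalisations agree because `G_0` corresponds to `G_0^⊥`. -/
theorem measurePreserving_dual (μ : Measure (Vilenkin p)) [μ.IsAddHaarMeasure]
    (hμ : μ (chain p 0 : Set (Vilenkin p)) = 1)
    (ν : Measure (Chars p)) [ν.IsHaarMeasure]
    (hν : ν (annih p 0 : Set (Chars p)) = 1) : MeasurePreserving dual μ ν := by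
  let e : Chars p ≃ᵐ Vilenkin p := dualHomeomorph.symm.toMeasurableEquiv
  have he : ∀ y, e (dual y) = y := fun y => dualHomeomorph.symm_apply_apply y
  have he' : ∀ χ, dual (e χ) = χ := fun χ => dualHomeomorph.apply_symm_apply χ
  have hmap : ∀ s, ν.map e s = ν (dual '' s) := fun s => by
    rw [e.map_apply]
    congr 1
    ext χ
    exact ⟨fun h => ⟨_, h, he' χ⟩, by rintro ⟨y, hy, rfl⟩; simpa [he] using hy⟩
  have : (ν.map e).IsAddLeftInvariant := ⟨fun g => by
    rw [Measure.map_map (measurable_const_add g) e.measurable]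
    have : (g + ·) ∘ e = e ∘ (dual g * ·) := by
      funext χ
      obtain ⟨y, rfl⟩ := dual_surjective χ
      simp only [Function.comp_apply, ← dual_add, he]
    rw [this, ← Measure.map_map e.measurable (measurable_const_mul _), map_mul_left_eq_self]⟩
  have : IsFiniteMeasureOnCompacts (ν.map e) := ⟨fun K hK => by
    rw [hmap]
    exact (hK.image continuous_dual).measure_lt_top⟩
  have h := Measure.isAddLeftInvariant_eq_smul (ν.map e) μ
  have h1 : (ν.map e) (chain p 0 : Set (Vilenkin p)) = 1 := by
    rw [e.map_apply, ← hν]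
    congr 1
    ext χ
    obtain ⟨y, rfl⟩ := dual_surjective χ
    simp [he, dual_mem_annih]
  have hc : Measure.addHaarScalarFactor (ν.map e) μ = 1 := by
    have := congrArg (fun m : Measure (Vilenkin p) => m (chain p 0 : Set (Vilenkin p))) h
    simp only [Measure.smul_apply, hμ, h1] at this
    simpa using this.symm
  rw [hc, one_smul] at h
  refine ⟨continuous_dual.measurable, ?_⟩
  rw [← h, Measure.map_map continuous_dual.measurable e.measurable]
  have : dual ∘ e = id := funext he'
  rw [this, Measure.map_id]

end Vilenkin

/-! ### Haar measure under dilation, and integrals of characters. -/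

namespace Vilenkin

variable {p : ℕ}

theorem measure_chain_succ [NeZero p] (μ : Measure (Vilenkin p)) [μ.IsAddHaarMeasure] (n : ℤ) :
    μ (chain p n : Set (Vilenkin p)) = p * μ (chain p (n + 1) : Set (Vilenkin p)) := by
  have h : (chain p n : Set (Vilenkin p)) = ⋃ a : ZMod p, ball (single n a) (n + 1) := by
    ext x
    simp only [SetLike.mem_coe, Set.mem_iUnion, mem_ball]
    refine ⟨fun hx => ⟨x.coord n, fun k hk => ?_⟩, fun ⟨a, ha⟩ k hk => ?_⟩
    · rw [coord_sub, coord_single]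
      split_ifs with h
      · rw [h, sub_self]
      · rw [hx k (by omega), sub_zero]
    · simpa [coord_single, hk.ne] using ha k (by omega)
  have hd : Pairwise (Function.onFun Disjoint fun a : ZMod p => ball (single n a) (n + 1)) := by
    intro a b hab
    refine Set.disjoint_left.2 fun x hx hx' => hab ?_
    have h1 := hx n (by omega)
    have h2 := hx' n (by omega)
    simp only [coord_sub, coord_single, if_true, sub_eq_zero] at h1 h2
    exact h1.symm.trans h2
  have hb : ∀ a, μ (ball (single n a) (n + 1)) = μ (chain p (n + 1) : Set (Vilenkin p)) :=
    fun a => by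
      rw [ball_eq_preimage]
      simp only [sub_eq_add_neg]
      exact measure_preimage_add_right μ _ _
  rw [h, measure_iUnion hd fun a => measurableSet_ball _ _, tsum_fintype]
  simp [hb, ZMod.card]

theorem measure_chain [NeZero p] (μ : Measure (Vilenkin p)) [μ.IsAddHaarMeasure]
    (hμ : μ (chain p 0 : Set (Vilenkin p)) = 1) (n : ℤ) :
    μ (chain p n : Set (Vilenkin p)) = ENNReal.ofReal ((p : ℝ) ^ (-n)) := by
  have hp : (0 : ℝ) < p := by exact_mod_cast Nat.pos_of_ne_zero (NeZero.ne p)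
  have hstep : ∀ k : ℤ, ENNReal.ofReal ((p : ℝ) ^ (-k)) =
      p * ENNReal.ofReal ((p : ℝ) ^ (-(k + 1))) := fun k => by
    rw [← ENNReal.ofReal_natCast p, ← ENNReal.ofReal_mul hp.le]
    congr 1
    rw [neg_add, zpow_add₀ hp.ne', zpow_neg_one]
    field_simp
  have hp0 : (p : ℝ≥0∞) ≠ 0 := by exact_mod_cast NeZero.ne p
  induction n using Int.induction_on with
  | zero => simp [hμ]
  | succ k ih =>
    rw [measure_chain_succ, hstep] at ih
    exact (ENNReal.mul_right_inj hp0 (ENNReal.natCast_ne_top p)).1 ih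
  | pred k ih =>
    rw [measure_chain_succ, hstep, sub_add_cancel, ih]

theorem map_dilate [NeZero p] (μ : Measure (Vilenkin p)) [μ.IsAddHaarMeasure]
    (hμ : μ (chain p 0 : Set (Vilenkin p)) = 1) (j : ℤ) :
    μ.map (dilate j) = ENNReal.ofReal ((p : ℝ) ^ (-j)) • μ := by
  have hemb := measurableEmbedding_dilate (p := p) j
  have : (μ.map (dilate j)).IsAddLeftInvariant := ⟨fun g => by
    rw [Measure.map_map (measurable_const_add g) hemb.measurable]
    have : (g + ·) ∘ dilate j = dilate j ∘ (dilate (-j) g + ·) := by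
      funext x
      simp [dilate_dilate]
    rw [this, ← Measure.map_map hemb.measurable (measurable_const_add _), map_add_left_eq_self]⟩
  have : IsFiniteMeasureOnCompacts (μ.map (dilate j)) := ⟨fun K hK => by
    rw [hemb.map_apply]
    exact ((dilateHomeomorph j).isCompact_preimage.2 hK).measure_lt_top⟩
  have h := Measure.isAddLeftInvariant_eq_smul (μ.map (dilate j)) μ
  have h1 : (μ.map (dilate j)) (chain p 0 : Set (Vilenkin p)) =
      ENNReal.ofReal ((p : ℝ) ^ (-j)) := by
    rw [hemb.map_apply, ← measure_chain μ hμ]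
    congr 1
    ext x
    simp [dilate_mem_chain]
  have hc : (Measure.addHaarScalarFactor (μ.map (dilate j)) μ : ℝ≥0∞) =
      ENNReal.ofReal ((p : ℝ) ^ (-j)) := by
    have := congrArg (fun m : Measure (Vilenkin p) => m (chain p 0 : Set (Vilenkin p))) h
    simp only [Measure.smul_apply, hμ, h1] at this
    rw [this, ENNReal.smul_def, smul_eq_mul, mul_one]
  rw [← hc]
  -- The scalar factor is fixed by the preimage of `G_0`, which is `G_j`, of measure `p^{-j}`.
  exact h

theorem lintegral_dilate [NeZero p] (μ : Measure (Vilenkin p)) [μ.IsAddHaarMeasure]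
    (hμ : μ (chain p 0 : Set (Vilenkin p)) = 1) (j : ℤ) (f : Vilenkin p → ℝ≥0∞) :
    ∫⁻ x, f (dilate j x) ∂μ = ENNReal.ofReal ((p : ℝ) ^ (-j)) * ∫⁻ x, f x ∂μ := by
  rw [← (measurableEmbedding_dilate j).lintegral_map, map_dilate μ hμ, lintegral_smul_measure,
    smul_eq_mul]

theorem integral_dilate [NeZero p] (μ : Measure (Vilenkin p)) [μ.IsAddHaarMeasure]
    (hμ : μ (chain p 0 : Set (Vilenkin p)) = 1) (j : ℤ) (f : Vilenkin p → ℂ) :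
    ∫ x, f (dilate j x) ∂μ = ((p : ℝ) ^ (-j) : ℝ) * ∫ x, f x ∂μ := by
  rw [← (measurableEmbedding_dilate j).integral_map, map_dilate μ hμ, integral_smul_measure,
    ENNReal.toReal_ofReal (by positivity), Complex.real_smul]

theorem memLp_dilate [NeZero p] {μ : Measure (Vilenkin p)} [μ.IsAddHaarMeasure]
    (hμ : μ (chain p 0 : Set (Vilenkin p)) = 1) (j : ℤ) {f : Vilenkin p → ℂ} (hf : MemLp f 2 μ) :
    MemLp (fun x => f (dilate j x)) 2 μ := by
  refine ((measurableEmbedding_dilate j).memLp_map_measure_iff).1 ?_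
  rw [map_dilate μ hμ]
  exact hf.smul_measure ENNReal.ofReal_ne_top

theorem memLp_sub {μ : Measure (Vilenkin p)} [NeZero p] [μ.IsAddHaarMeasure]
    (a : Vilenkin p) {f : Vilenkin p → ℂ} (hf : MemLp f 2 μ) :
    MemLp (fun x => f (x - a)) 2 μ :=
  hf.comp_measurePreserving (measurePreserving_sub_right μ a)

variable [NeZero p]

/-- The values of the self-duality of `G`. -/
def pairing (y x : Vilenkin p) : ℂ := ev (dual y) x

theorem pairing_eq (y x : Vilenkin p) : pairing y x = (ZMod.toCircle (residue y x) : ℂ) := rfl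

theorem pairing_comm (y x : Vilenkin p) : pairing y x = pairing x y := by
  rw [pairing_eq, residue_comm, ← pairing_eq]

theorem pairing_add_right (y x x' : Vilenkin p) :
    pairing y (x + x') = pairing y x * pairing y x' := by
  simp [pairing_eq, residue_add_right, AddChar.map_add_eq_mul]

theorem pairing_add_left (y y' x : Vilenkin p) :
    pairing (y + y') x = pairing y x * pairing y' x := by
  simp only [pairing_comm _ x, pairing_add_right]

theorem pairing_eq_one {n : ℤ} {y x : Vilenkin p} (hy : y ∈ chain p (-n)) (hx : x ∈ chain p n) :
    pairing y x = 1 := by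
  simp [pairing_eq, residue_eq_zero hy hx]

@[simp] theorem pairing_zero_right (y : Vilenkin p) : pairing y 0 = 1 := by
  simp [pairing_eq, residue_zero_right]

@[simp] theorem pairing_zero_left (x : Vilenkin p) : pairing 0 x = 1 := by
  rw [pairing_comm, pairing_zero_right]

@[simp] theorem norm_pairing (y x : Vilenkin p) : ‖pairing y x‖ = 1 := Circle.norm_coe _

@[simp] theorem enorm_pairing (y x : Vilenkin p) : ‖pairing y x‖ₑ = 1 := by
  rw [← ofReal_norm, norm_pairing, ENNReal.ofReal_one]

theorem pairing_neg_left (y x : Vilenkin p) : pairing (-y) x = (starRingEnd ℂ) (pairing y x) := by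
  have h : pairing (-y) x * pairing y x = 1 := by simp [← pairing_add_left]
  rw [eq_inv_of_mul_eq_one_left h, Complex.inv_eq_conj (norm_pairing y x)]

theorem pairing_dilate (j : ℤ) (y x : Vilenkin p) :
    pairing (dilate j y) x = pairing y (dilate j x) := by
  simp [pairing_eq, residue_dilate]

theorem continuous_uncurry_pairing :
    Continuous fun z : Vilenkin p × Vilenkin p => pairing z.1 z.2 :=
  continuous_subtype_val.comp continuous_toCircle_residue

theorem continuous_pairing (y : Vilenkin p) : Continuous (pairing y) :=
  continuous_subtype_val.comp (continuous_toCircle_residue_right y)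

theorem exists_pairing_ne_one {n : ℤ} {y : Vilenkin p} (hy : y ∉ chain p (-n)) :
    ∃ x ∈ chain p n, pairing y x ≠ 1 := by
  rw [← dual_mem_annih] at hy
  by_contra! h
  exact hy fun x hx => Circle.coe_eq_one.1 (h x hx)

theorem setIntegral_pairing (μ : Measure (Vilenkin p)) [μ.IsAddHaarMeasure]
    (hμ : μ (chain p 0 : Set (Vilenkin p)) = 1) (n : ℤ) (y : Vilenkin p) :
    ∫ x in (chain p n : Set (Vilenkin p)), pairing y x ∂μ =
      (chain p (-n) : Set (Vilenkin p)).indicator (fun _ => (((p : ℝ) ^ (-n) : ℝ) : ℂ)) y := by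
  by_cases hy : y ∈ chain p (-n)
  · rw [Set.indicator_of_mem hy, setIntegral_congr_fun (g := fun _ => (1 : ℂ))
      (measurableSet_chain n) fun x hx => pairing_eq_one hy hx]
    rw [setIntegral_const, Measure.real, measure_chain μ hμ, ENNReal.toReal_ofReal (by positivity),
      Complex.real_smul, mul_one]
  · rw [Set.indicator_of_notMem hy]
    obtain ⟨a, ha, ha'⟩ := exists_pairing_ne_one hy
    -- Translating by an element of `G_n` on which the character is not `1` multiplies the integral
    -- by that value, so the integral vanishes.
    have h : ∫ x in (chain p n : Set (Vilenkin p)), pairing y x ∂μ =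
        pairing y a * ∫ x in (chain p n : Set (Vilenkin p)), pairing y x ∂μ := by
      rw [← integral_const_mul, ← integral_indicator (measurableSet_chain n),
        ← integral_indicator (measurableSet_chain n), ← integral_add_left_eq_self _ a]
      refine integral_congr_ae (ae_of_all _ fun x => ?_)
      have hiff : a + x ∈ chain p n ↔ x ∈ chain p n := (chain p n).add_mem_cancel_left ha
      change (chain p n : Set (Vilenkin p)).indicator _ (a + x) = _
      by_cases hx : x ∈ chain p n
      · rw [Set.indicator_of_mem (hiff.2 hx), Set.indicator_of_mem (SetLike.mem_coe.2 hx),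
          pairing_add_right]
      · rw [Set.indicator_of_notMem (fun h => hx (hiff.1 h)), Set.indicator_of_notMem hx]
    by_contra h0
    exact ha' (mul_right_cancel₀ h0 (by rw [one_mul, ← h]))

theorem eLpNorm_two_sq {α : Type*} {E : Type*} [NormedAddCommGroup E] [MeasurableSpace α]
    (μ : Measure α) (f : α → E) : eLpNorm f 2 μ ^ 2 = ∫⁻ x, ‖f x‖ₑ ^ 2 ∂μ := by
  have h := eLpNorm_nnreal_pow_eq_lintegral (μ := μ) (f := f) (p := 2) two_ne_zero
  simpa using h

theorem eLpNorm_two_eq {α : Type*} {E : Type*} [NormedAddCommGroup E] [MeasurableSpace α]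
    (μ : Measure α) (f : α → E) : eLpNorm f 2 μ = (∫⁻ x, ‖f x‖ₑ ^ 2 ∂μ) ^ (1 / 2 : ℝ) := by
  rw [← eLpNorm_two_sq, ← ENNReal.rpow_natCast, ← ENNReal.rpow_mul]
  norm_num

theorem enorm_sq_toLp {α : Type*} [MeasurableSpace α] {μ : Measure α} {f : α → ℂ}
    (hf : MemLp f 2 μ) : ‖hf.toLp f‖ₑ ^ 2 = ∫⁻ x, ‖f x‖ₑ ^ 2 ∂μ := by
  rw [Lp.enorm_toLp, eLpNorm_two_sq]

end Vilenkin

/-! ### Completeness of characters and Plancherel on the subgroups `G_n`. -/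

namespace Vilenkin

variable {p : ℕ}

theorem isPiSystem_balls :
    IsPiSystem (insert ∅ (Set.range fun i : finitary p × ℤ => ball i.1.1 i.2)) := by
  refine IsPiSystem.insert_empty ?_
  rintro _ ⟨⟨a, m⟩, rfl⟩ _ ⟨⟨b, n⟩, rfl⟩ ⟨z, hz, hz'⟩
  rcases le_total m n with h | h
  · rw [Set.inter_eq_right.2 (ball_subset_ball h hz hz')]
    exact ⟨(b, n), rfl⟩
  · rw [Set.inter_eq_left.2 (ball_subset_ball h hz' hz)]
    exact ⟨(a, m), rfl⟩

variable [NeZero p]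

instance isFiniteMeasure_restrict_chain (μ : Measure (Vilenkin p)) [μ.IsAddHaarMeasure] (n : ℤ) :
    IsFiniteMeasure (μ.restrict (chain p n : Set (Vilenkin p))) :=
  ⟨by rw [Measure.restrict_apply_univ]; exact (isCompact_chain n).measure_lt_top⟩

theorem integrable_pairing_mul {μ : Measure (Vilenkin p)} {g : Vilenkin p → ℂ}
    (hg : Integrable g μ) (y : Vilenkin p) :
    Integrable (fun x => (starRingEnd ℂ) (pairing y x) * g x) μ :=
  hg.bdd_mul (c := 1) (Complex.continuous_conj.comp (continuous_pairing y)).aestronglyMeasurable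
    (ae_of_all _ fun x => by simp)

/-- The average of `(y, a - x)` over `y ∈ G_{-n}` is a multiple of the indicator of the ball around
`a`. By Fubini, vanishing Fourier integrals therefore give vanishing integrals over balls. -/
theorem setIntegral_ball_eq_zero (μ : Measure (Vilenkin p)) [μ.IsAddHaarMeasure]
    (hμ : μ (chain p 0 : Set (Vilenkin p)) = 1) {ρ : Measure (Vilenkin p)} [IsFiniteMeasure ρ]
    {g : Vilenkin p → ℂ} (hg : Integrable g ρ)
    (h : ∀ y, ∫ x, (starRingEnd ℂ) (pairing y x) * g x ∂ρ = 0) (a : Vilenkin p) (n : ℤ) :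
    ∫ x in ball a n, g x ∂ρ = 0 := by
  have hp : (p : ℝ) ≠ 0 := by exact_mod_cast NeZero.ne p
  have hc : Continuous fun z : Vilenkin p × Vilenkin p => pairing z.1 (a - z.2) :=
    Continuous.comp (f := fun z : Vilenkin p × Vilenkin p => (z.1, a - z.2))
      continuous_uncurry_pairing (continuous_fst.prodMk (continuous_const.sub continuous_snd))
  have hg2 : Integrable (fun z : Vilenkin p × Vilenkin p => g z.2)
      ((μ.restrict (chain p (-n) : Set (Vilenkin p))).prod ρ) := hg.comp_snd _
  have hint : Integrable (fun z : Vilenkin p × Vilenkin p => pairing z.1 (a - z.2) * g z.2)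
      ((μ.restrict (chain p (-n) : Set (Vilenkin p))).prod ρ) :=
    hg2.bdd_mul (c := 1) hc.aestronglyMeasurable (ae_of_all _ fun z => (norm_pairing _ _).le)
  have hswap := integral_integral_swap (f := fun y x => pairing y (a - x) * g x) hint
  have h1 : ∀ y, ∫ x, pairing y (a - x) * g x ∂ρ = 0 := fun y => by
    have : ∀ x, pairing y (a - x) * g x =
        pairing y a * ((starRingEnd ℂ) (pairing y x) * g x) := fun x => by
      rw [sub_eq_add_neg, pairing_add_right, pairing_comm y (-x), pairing_neg_left,
        pairing_comm x, mul_assoc]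
    simp only [this]
    rw [integral_const_mul, h, mul_zero]
  have h2 : ∀ x, ∫ y in (chain p (-n) : Set (Vilenkin p)), pairing y (a - x) * g x ∂μ =
      (((p : ℝ) ^ n : ℝ) : ℂ) * (ball a n).indicator g x := fun x => by
    simp only [pairing_comm _ (a - x)]
    rw [integral_mul_const, setIntegral_pairing μ hμ, neg_neg]
    have hiff : a - x ∈ chain p n ↔ x ∈ ball a n := by
      rw [mem_ball, ← neg_mem_iff, neg_sub]
    by_cases hx : x ∈ ball a n
    · rw [Set.indicator_of_mem (hiff.2 hx), Set.indicator_of_mem hx]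
    · rw [Set.indicator_of_notMem (fun h => hx (hiff.1 h)), Set.indicator_of_notMem hx]
      simp
  simp only [h1, h2, integral_zero] at hswap
  rw [integral_const_mul, integral_indicator (measurableSet_ball a n)] at hswap
  refine (mul_eq_zero.1 hswap.symm).resolve_left ?_
  exact_mod_cast zpow_ne_zero n hp

/-- Completeness of the characters: the integrals over balls vanish, and a π-λ argument extends this
to all Borel sets. -/
theorem ae_eq_zero_of_forall_integral_pairing (μ : Measure (Vilenkin p)) [μ.IsAddHaarMeasure]
    (hμ : μ (chain p 0 : Set (Vilenkin p)) = 1) {g : Vilenkin p → ℂ}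
    (hg : IntegrableOn g (chain p 0) μ)
    (h : ∀ y, ∫ x in (chain p 0 : Set (Vilenkin p)), (starRingEnd ℂ) (pairing y x) * g x ∂μ = 0) :
    g =ᵐ[μ.restrict (chain p 0 : Set (Vilenkin p))] 0 := by
  have huniv : ∫ x, g x ∂(μ.restrict (chain p 0 : Set (Vilenkin p))) = 0 := by
    simpa using h 0
  refine hg.ae_eq_zero_of_forall_setIntegral_eq_zero fun s hs _ => ?_
  have hgen : (inferInstance : MeasurableSpace (Vilenkin p)) = MeasurableSpace.generateFrom
      (insert ∅ (Set.range fun i : finitary p × ℤ => ball i.1.1 i.2)) := by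
    rw [MeasurableSpace.generateFrom_insert_empty]
    exact isTopologicalBasis_ball.borel_eq_generateFrom
  induction s, hs using MeasurableSpace.induction_on_inter hgen isPiSystem_balls with
  | empty => simp
  | basic t ht =>
    rcases ht with rfl | ⟨i, rfl⟩
    · simp
    · exact setIntegral_ball_eq_zero μ hμ hg h _ _
  | compl t ht ih =>
    have := integral_add_compl ht hg
    rwa [ih (measure_lt_top _ _), huniv, zero_add] at this
  | iUnion t hd ht ih =>
    rw [integral_iUnion ht hd hg.integrableOn]
    simp [fun i => ih i (measure_lt_top _ _)]

theorem memLp_pairing {ρ : Measure (Vilenkin p)} [IsFiniteMeasure ρ] (y : Vilenkin p) :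
    MemLp (pairing y) 2 ρ :=
  MemLp.of_bound (continuous_pairing y).aestronglyMeasurable 1 (ae_of_all _ fun x => by simp)

theorem integral_pairing_congr (μ : Measure (Vilenkin p)) {n : ℤ} {y z : Vilenkin p}
    (h : y - z ∈ chain p (-n)) (g : Vilenkin p → ℂ) :
    ∫ x in (chain p n : Set (Vilenkin p)), (starRingEnd ℂ) (pairing y x) * g x ∂μ =
      ∫ x in (chain p n : Set (Vilenkin p)), (starRingEnd ℂ) (pairing z x) * g x ∂μ := by
  refine setIntegral_congr_fun (measurableSet_chain n) fun x hx => ?_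
  have : pairing y x = pairing z x := by
    rw [← sub_add_cancel y z, pairing_add_left, pairing_eq_one h hx, one_mul]
  simp only [this]

theorem tsum_enorm_inner_sq {ι E : Type*} [NormedAddCommGroup E]
    [InnerProductSpace ℂ E] (b : HilbertBasis ι ℂ E) (v : E) :
    ∑' i, ‖inner ℂ (b i) v‖ₑ ^ 2 = ‖v‖ₑ ^ 2 := by
  have h := (b.hasSum_inner_mul_inner v v).mapL Complex.reCLM
  have h' : HasSum (fun i => ‖inner ℂ (b i) v‖ ^ 2) (‖v‖ ^ 2) := by
    convert! h using 1
    · funext i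
      rw [← inner_conj_symm v (b i), ← Complex.normSq_eq_conj_mul_self]
      simp only [Complex.normSq_eq_norm_sq, Complex.reCLM_apply, Complex.ofReal_re]
    · simp [inner_self_eq_norm_sq_to_K, ← Complex.ofReal_pow]
  have h2 := ENNReal.ofReal_tsum_of_nonneg (fun i => by positivity) h'.summable
  rw [h'.tsum_eq] at h2
  simpa [ENNReal.ofReal_pow, ofReal_norm] using h2.symm

/-- The characters `x ↦ (h, x)`, `h ∈ H₀`, as elements of `L₂(G_0)`. -/
def pairingLp (μ : Measure (Vilenkin p)) [μ.IsAddHaarMeasure] (h : H0 p) :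
    Lp ℂ 2 (μ.restrict (chain p 0 : Set (Vilenkin p))) :=
  (memLp_pairing h.1).toLp _

theorem inner_pairingLp (μ : Measure (Vilenkin p)) [μ.IsAddHaarMeasure] (h : H0 p)
    (u : Lp ℂ 2 (μ.restrict (chain p 0 : Set (Vilenkin p)))) :
    inner ℂ (pairingLp μ h) u =
      ∫ x in (chain p 0 : Set (Vilenkin p)), (starRingEnd ℂ) (pairing h x) * u x ∂μ := by
  rw [L2.inner_def]
  refine integral_congr_ae ?_
  filter_upwards [(memLp_pairing h.1).coeFn_toLp] with x hx
  rw [pairingLp, hx, RCLike.inner_apply, mul_comm]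

theorem orthonormal_pairingLp (μ : Measure (Vilenkin p)) [μ.IsAddHaarMeasure]
    (hμ : μ (chain p 0 : Set (Vilenkin p)) = 1) : Orthonormal ℂ (pairingLp (p := p) μ) := by
  classical
  rw [orthonormal_iff_ite]
  intro h h'
  have : inner ℂ (pairingLp μ h) (pairingLp μ h') =
      ∫ x in (chain p 0 : Set (Vilenkin p)), pairing (h'.1 - h.1) x ∂μ := by
    rw [inner_pairingLp]
    refine integral_congr_ae ?_
    filter_upwards [(memLp_pairing h'.1).coeFn_toLp] with x hx
    rw [pairingLp, hx, ← pairing_neg_left, ← pairing_add_left, neg_add_eq_sub]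
  rw [this, setIntegral_pairing μ hμ, neg_zero]
  split_ifs with heq
  · simp [heq]
  · refine Set.indicator_of_notMem (fun hm => heq ?_) _
    exact (Subtype.ext (eq_of_sub_mem_chain_zero h'.2 h.2 hm)).symm

/-- The characters `x ↦ (h, x)`, `h ∈ H₀`, form a Hilbert basis of `L₂(G_0)`. -/
def pairingBasis (μ : Measure (Vilenkin p)) [μ.IsAddHaarMeasure]
    (hμ : μ (chain p 0 : Set (Vilenkin p)) = 1) :
    HilbertBasis (H0 p) ℂ (Lp ℂ 2 (μ.restrict (chain p 0 : Set (Vilenkin p)))) :=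
  HilbertBasis.mkOfOrthogonalEqBot (orthonormal_pairingLp μ hμ) <| by
    refine (Submodule.eq_bot_iff _).2 fun u hu => ?_
    rw [Lp.eq_zero_iff_ae_eq_zero]
    refine ae_eq_zero_of_forall_integral_pairing μ hμ
      ((Lp.memLp u).integrable (by norm_num)) fun y => ?_
    -- On `G_0` a character depends only on the coset of `y` modulo `G_0`, so orthogonality to those
    -- indexed by `H₀` covers all of them.
    obtain ⟨h, hh, hy⟩ := exists_H0_sub_mem y
    rw [integral_pairing_congr μ (by rw [neg_zero]; exact hy), ← inner_pairingLp μ ⟨h, hh⟩]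
    exact (Submodule.mem_orthogonal _ _).1 hu _ (Submodule.subset_span ⟨_, rfl⟩)

theorem parseval_chain_zero (μ : Measure (Vilenkin p)) [μ.IsAddHaarMeasure]
    (hμ : μ (chain p 0 : Set (Vilenkin p)) = 1) {g : Vilenkin p → ℂ}
    (hg : MemLp g 2 (μ.restrict (chain p 0 : Set (Vilenkin p)))) :
    ∑' h : H0 p, ‖∫ x in (chain p 0 : Set (Vilenkin p)),
      (starRingEnd ℂ) (pairing h x) * g x ∂μ‖ₑ ^ 2 =
      ∫⁻ x in (chain p 0 : Set (Vilenkin p)), ‖g x‖ₑ ^ 2 ∂μ := by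
  rw [← enorm_sq_toLp hg, ← tsum_enorm_inner_sq (pairingBasis μ hμ)]
  refine tsum_congr fun h => ?_
  rw [pairingBasis, HilbertBasis.coe_mkOfOrthogonalEqBot, inner_pairingLp]
  congr 2
  refine integral_congr_ae ?_
  filter_upwards [hg.coeFn_toLp] with x hx
  rw [hx]

/-- The transform is constant on the cosets `h + G_0`, which have measure one and tile `G`; its
integral is therefore the Parseval sum over `H₀`. -/
theorem plancherel_chain_zero (μ : Measure (Vilenkin p)) [μ.IsAddHaarMeasure]
    (hμ : μ (chain p 0 : Set (Vilenkin p)) = 1) {g : Vilenkin p → ℂ}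
    (hg : MemLp g 2 (μ.restrict (chain p 0 : Set (Vilenkin p)))) :
    ∫⁻ y, ‖∫ x in (chain p 0 : Set (Vilenkin p)),
      (starRingEnd ℂ) (pairing y x) * g x ∂μ‖ₑ ^ 2 ∂μ =
      ∫⁻ x in (chain p 0 : Set (Vilenkin p)), ‖g x‖ₑ ^ 2 ∂μ := by
  have hU : (Set.univ : Set (Vilenkin p)) = ⋃ h : H0 p, ball h.1 0 := by
    ext x
    obtain ⟨h, hh, hx⟩ := exists_H0_sub_mem x
    simpa using ⟨h, hh, hx⟩
  have hd : Pairwise (Function.onFun Disjoint fun h : H0 p => ball h.1 0) := by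
    intro h h' hne
    refine Set.disjoint_left.2 fun x hx hx' => hne (Subtype.ext ?_)
    refine eq_of_sub_mem_chain_zero h.2 h'.2 ?_
    simpa using (chain p 0).sub_mem hx' hx
  have hb : ∀ a : Vilenkin p, μ (ball a 0) = 1 := fun a => by
    rw [ball_eq_preimage, ← hμ]
    simp only [sub_eq_add_neg]
    exact measure_preimage_add_right μ _ _
  rw [← parseval_chain_zero μ hμ hg, ← setLIntegral_univ, hU,
    lintegral_iUnion (fun h => measurableSet_ball _ _) hd]
  refine tsum_congr fun h => ?_
  rw [setLIntegral_congr_fun (g := fun _ => ‖∫ x in (chain p 0 : Set (Vilenkin p)),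
      (starRingEnd ℂ) (pairing h x) * g x ∂μ‖ₑ ^ 2) (measurableSet_ball h.1 0) (fun y hy => by
    simp only [integral_pairing_congr μ (n := 0) (by rw [neg_zero]; exact hy)]), lintegral_const,
    Measure.restrict_apply_univ, hb, mul_one]

theorem plancherel_chain (μ : Measure (Vilenkin p)) [μ.IsAddHaarMeasure]
    (hμ : μ (chain p 0 : Set (Vilenkin p)) = 1) {f : Vilenkin p → ℂ} (hf : MemLp f 2 μ) (n : ℤ) :
    ∫⁻ y, ‖∫ x in (chain p n : Set (Vilenkin p)),
      (starRingEnd ℂ) (pairing y x) * f x ∂μ‖ₑ ^ 2 ∂μ =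
      ∫⁻ x in (chain p n : Set (Vilenkin p)), ‖f x‖ₑ ^ 2 ∂μ := by
  have hp : (0 : ℝ) < p := by exact_mod_cast Nat.pos_of_ne_zero (NeZero.ne p)
  -- The case of `G_n` is the case of `G_0` for a dilate of `f`: both sides acquire the same factor
  -- `p^n`.
  have h := plancherel_chain_zero μ hμ ((memLp_dilate hμ (-n) hf).restrict (chain p 0))
  have hmem : ∀ x, dilate (-n) x ∈ chain p n ↔ x ∈ chain p 0 := fun x => by
    rw [dilate_mem_chain, add_neg_cancel]
  have h1 : ∀ y, ∫ x in (chain p 0 : Set (Vilenkin p)),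
      (starRingEnd ℂ) (pairing y x) * f (dilate (-n) x) ∂μ = ((p : ℝ) ^ n : ℝ) *
      ∫ x in (chain p n : Set (Vilenkin p)),
        (starRingEnd ℂ) (pairing (dilate n y) x) * f x ∂μ := fun y => by
    rw [← integral_indicator (measurableSet_chain 0), ← integral_indicator (measurableSet_chain n)]
    conv_rhs => rw [← neg_neg n, ← integral_dilate μ hμ, neg_neg]
    refine integral_congr_ae (ae_of_all _ fun x => ?_)
    by_cases hx : x ∈ chain p 0
    · simp only
      rw [Set.indicator_of_mem (SetLike.mem_coe.2 hx), Set.indicator_of_mem ((hmem x).2 hx),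
        pairing_dilate, dilate_dilate, add_neg_cancel, dilate_zero]
    · simp only
      rw [Set.indicator_of_notMem hx, Set.indicator_of_notMem (fun h => hx ((hmem x).1 h))]
  have h2 : ∫⁻ x in (chain p 0 : Set (Vilenkin p)), ‖f (dilate (-n) x)‖ₑ ^ 2 ∂μ =
      ENNReal.ofReal ((p : ℝ) ^ n) *
        ∫⁻ x in (chain p n : Set (Vilenkin p)), ‖f x‖ₑ ^ 2 ∂μ := by
    rw [← lintegral_indicator (measurableSet_chain 0),
      ← lintegral_indicator (measurableSet_chain n)]
    conv_rhs => rw [← neg_neg n, ← lintegral_dilate μ hμ, neg_neg]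
    refine lintegral_congr fun x => ?_
    by_cases hx : x ∈ chain p 0
    · rw [Set.indicator_of_mem (SetLike.mem_coe.2 hx), Set.indicator_of_mem ((hmem x).2 hx)]
    · rw [Set.indicator_of_notMem hx, Set.indicator_of_notMem (fun h => hx ((hmem x).1 h))]
  have hc : ‖(((p : ℝ) ^ n : ℝ) : ℂ)‖ₑ = ENNReal.ofReal ((p : ℝ) ^ n) := by
    rw [← ofReal_norm, Complex.norm_real, Real.norm_of_nonneg (by positivity)]
  simp only [h1, enorm_mul, mul_pow, hc] at h
  rw [h2, lintegral_const_mul' _ _ (by finiteness), lintegral_dilate μ hμ n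
    (fun y => ‖∫ x in (chain p n : Set (Vilenkin p)),
      (starRingEnd ℂ) (pairing y x) * f x ∂μ‖ₑ ^ 2), ← mul_assoc] at h
  have hpn : (0 : ℝ) < (p : ℝ) ^ n := by positivity
  rw [← ENNReal.ofReal_pow hpn.le, ← ENNReal.ofReal_mul (by positivity), zpow_neg, sq,
    mul_assoc, mul_inv_cancel₀ hpn.ne', mul_one] at h
  exact (ENNReal.mul_right_inj (by simpa using hpn) ENNReal.ofReal_ne_top).1 h

end Vilenkin

/-! ### The Fourier transform on `L₂(G)`. -/

namespace Vilenkin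

variable {p : ℕ}

theorem tendsto_setLIntegral_chain (μ : Measure (Vilenkin p)) (f : Vilenkin p → ℝ≥0∞) :
    Tendsto (fun n : ℕ => ∫⁻ x in (chain p (-(n : ℤ)) : Set (Vilenkin p)), f x ∂μ) atTop
      (𝓝 (∫⁻ x, f x ∂μ)) := by
  have hmono : Monotone fun n : ℕ => (chain p (-(n : ℤ)) : Set (Vilenkin p)) :=
    fun m n h => chain_antitone (by omega)
  have hU : (⋃ n : ℕ, (chain p (-(n : ℤ)) : Set (Vilenkin p))) = Set.univ :=
    Set.eq_univ_of_forall fun x => Set.mem_iUnion.2 (exists_mem_chain x)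
  have h := tendsto_measure_iUnion_atTop (μ := μ.withDensity f) hmono
  rw [hU, withDensity_apply _ MeasurableSet.univ, setLIntegral_univ] at h
  refine h.congr fun n => ?_
  rw [Function.comp_apply, withDensity_apply _ (measurableSet_chain _)]

theorem tendsto_setLIntegral_compl_chain {μ : Measure (Vilenkin p)} {f : Vilenkin p → ℝ≥0∞} (hf : ∫⁻ x, f x ∂μ ≠ ∞) :
    Tendsto (fun n : ℕ => ∫⁻ x in (chain p (-(n : ℤ)) : Set (Vilenkin p))ᶜ, f x ∂μ) atTop
      (𝓝 0) := by
  have hanti : Antitone fun n : ℕ => (chain p (-(n : ℤ)) : Set (Vilenkin p))ᶜ :=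
    fun m n h => Set.compl_subset_compl.2 (chain_antitone (by omega))
  have hI : (⋂ n : ℕ, (chain p (-(n : ℤ)) : Set (Vilenkin p))ᶜ) = ∅ := by
    rw [← Set.compl_iUnion, Set.eq_univ_of_forall fun x => Set.mem_iUnion.2 (exists_mem_chain x),
      Set.compl_univ]
  have h := tendsto_measure_iInter_atTop (μ := μ.withDensity f)
    (fun n => (measurableSet_chain _).compl.nullMeasurableSet) hanti ⟨0, by
      rw [withDensity_apply _ (measurableSet_chain _).compl]
      exact ((setLIntegral_le_lintegral _ _).trans_lt hf.lt_top).ne⟩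
  rw [hI, measure_empty] at h
  refine h.congr fun n => ?_
  rw [Function.comp_apply, withDensity_apply _ (measurableSet_chain _).compl]

variable [NeZero p]

/-- The Fourier integral over `G_n` as a function on `G`, through the self-duality. -/
def fourierChain (μ : Measure (Vilenkin p)) (n : ℤ) (f : Vilenkin p → ℂ) (y : Vilenkin p) : ℂ :=
  ∫ x in (chain p n : Set (Vilenkin p)), (starRingEnd ℂ) (pairing y x) * f x ∂μ

theorem fourierOn_chain_dual (μ : Measure (Vilenkin p)) (n : ℤ) (f : Vilenkin p → ℂ)
    (y : Vilenkin p) : fourierOn μ (chain p n) f (dual y) = fourierChain μ n f y := by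
  simp only [fourierOn, fourierChain, pairing, mul_comm]

theorem continuous_fourierChain (μ : Measure (Vilenkin p)) (n : ℤ) (f : Vilenkin p → ℂ) :
    Continuous (fourierChain μ n f) := by
  refine continuous_iff_continuousAt.2 fun y => ?_
  refine continuousAt_const.congr (f := fun _ => fourierChain μ n f y) ?_
  filter_upwards [(isOpen_ball y (-n)).mem_nhds (by simp [mem_ball])] with z hz
  exact (integral_pairing_congr μ hz f).symm

theorem fourierChain_congr {μ : Measure (Vilenkin p)} {f g : Vilenkin p → ℂ} (h : f =ᵐ[μ] g)
    (n : ℤ) : fourierChain μ n f = fourierChain μ n g := by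
  funext y
  refine integral_congr_ae ?_
  filter_upwards [ae_restrict_of_ae h] with x hx
  rw [hx]

theorem fourierChain_smul (μ : Measure (Vilenkin p)) (c : ℂ) (f : Vilenkin p → ℂ) (n : ℤ) :
    fourierChain μ n (c • f) = c • fourierChain μ n f := by
  funext y
  simp only [fourierChain, Pi.smul_apply, smul_eq_mul, mul_left_comm _ c, integral_const_mul]

section

variable {μ : Measure (Vilenkin p)} [μ.IsAddHaarMeasure]

theorem lintegral_fourierChain (hμ : μ (chain p 0 : Set (Vilenkin p)) = 1) {f : Vilenkin p → ℂ}
    (hf : MemLp f 2 μ) (n : ℤ) :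
    ∫⁻ y, ‖fourierChain μ n f y‖ₑ ^ 2 ∂μ =
      ∫⁻ x in (chain p n : Set (Vilenkin p)), ‖f x‖ₑ ^ 2 ∂μ :=
  plancherel_chain μ hμ hf n

theorem lintegral_sq_lt_top {α : Type*} [MeasurableSpace α] {μ : Measure α} {f : α → ℂ}
    (hf : MemLp f 2 μ) : ∫⁻ x, ‖f x‖ₑ ^ 2 ∂μ < ∞ := by
  rw [← eLpNorm_two_sq]
  exact ENNReal.pow_lt_top hf.2

theorem memLp_fourierChain (hμ : μ (chain p 0 : Set (Vilenkin p)) = 1) {f : Vilenkin p → ℂ}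
    (hf : MemLp f 2 μ) (n : ℤ) : MemLp (fourierChain μ n f) 2 μ := by
  refine ⟨(continuous_fourierChain μ n f).aestronglyMeasurable, ?_⟩
  rw [eLpNorm_two_eq, lintegral_fourierChain hμ hf]
  refine ENNReal.rpow_lt_top_of_nonneg (by norm_num) ?_
  exact ((setLIntegral_le_lintegral _ _).trans_lt (lintegral_sq_lt_top hf)).ne

theorem integrableOn_pairing_mul {f : Vilenkin p → ℂ} (hf : MemLp f 2 μ) (n : ℤ)
    (y : Vilenkin p) :
    IntegrableOn (fun x => (starRingEnd ℂ) (pairing y x) * f x) (chain p n) μ :=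
  integrable_pairing_mul ((hf.restrict _).integrable (by norm_num)) y

theorem fourierChain_add {f g : Vilenkin p → ℂ} (hf : MemLp f 2 μ) (hg : MemLp g 2 μ) (n : ℤ) :
    fourierChain μ n (f + g) = fourierChain μ n f + fourierChain μ n g := by
  funext y
  simp only [fourierChain, Pi.add_apply, mul_add]
  exact integral_add (integrableOn_pairing_mul hf n y) (integrableOn_pairing_mul hg n y)

/-- The Fourier integral over `G_n` as a linear map of `L₂(G)`. -/
def fourierChainLp (hμ : μ (chain p 0 : Set (Vilenkin p)) = 1) (n : ℤ) :
    Lp ℂ 2 μ →ₗ[ℂ] Lp ℂ 2 μ where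
  toFun f := (memLp_fourierChain hμ (Lp.memLp f) n).toLp _
  map_add' f g := by
    rw [← MemLp.toLp_add, MemLp.toLp_eq_toLp_iff, fourierChain_congr (Lp.coeFn_add f g),
      fourierChain_add (Lp.memLp f) (Lp.memLp g)]
  map_smul' c f := by
    rw [RingHom.id_apply, ← MemLp.toLp_const_smul, MemLp.toLp_eq_toLp_iff,
      fourierChain_congr (Lp.coeFn_smul c f), fourierChain_smul]

theorem fourierChainLp_apply (hμ : μ (chain p 0 : Set (Vilenkin p)) = 1) (n : ℤ)
    (f : Lp ℂ 2 μ) :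
    fourierChainLp hμ n f = (memLp_fourierChain hμ (Lp.memLp f) n).toLp _ := rfl

theorem enorm_fourierChainLp_sq (hμ : μ (chain p 0 : Set (Vilenkin p)) = 1) (n : ℤ)
    (f : Lp ℂ 2 μ) : ‖fourierChainLp hμ n f‖ₑ ^ 2 =
      ∫⁻ x in (chain p n : Set (Vilenkin p)), ‖f x‖ₑ ^ 2 ∂μ := by
  rw [← lintegral_fourierChain hμ (Lp.memLp f)]
  exact enorm_sq_toLp (memLp_fourierChain hμ (Lp.memLp f) n)

/-- Writing the difference as one transform lets Plancherel bound it by the tail of `f` outside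
`G_m`, which gives the Cauchy property. -/
theorem fourierChain_sub_eq_indicator {f : Vilenkin p → ℂ} (hf : MemLp f 2 μ) {m n : ℤ}
    (h : n ≤ m) : fourierChain μ n f - fourierChain μ m f =
      fourierChain μ n ((chain p m : Set (Vilenkin p))ᶜ.indicator f) := by
  have hi := hf.indicator (measurableSet_chain (p := p) m)
  have hc := hf.indicator (measurableSet_chain (p := p) m).compl
  have h1 : fourierChain μ m f =
      fourierChain μ n ((chain p m : Set (Vilenkin p)).indicator f) := by
    funext y
    have : (fun x => (starRingEnd ℂ) (pairing y x) *
        (chain p m : Set (Vilenkin p)).indicator f x) =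
        (chain p m : Set (Vilenkin p)).indicator
          fun x => (starRingEnd ℂ) (pairing y x) * f x := by
      funext x
      by_cases hx : x ∈ (chain p m : Set (Vilenkin p)) <;> simp [hx]
    rw [fourierChain, fourierChain, this, setIntegral_indicator (measurableSet_chain m),
      Set.inter_eq_right.2 (chain_antitone h)]
  rw [h1, sub_eq_iff_eq_add', ← fourierChain_add hi hc, Set.indicator_self_add_compl]

theorem edist_fourierChainLp_le (hμ : μ (chain p 0 : Set (Vilenkin p)) = 1) (f : Lp ℂ 2 μ)
    {m n : ℤ} (h : n ≤ m) :
    edist (fourierChainLp hμ n f) (fourierChainLp hμ m f) ≤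
      (∫⁻ x in (chain p m : Set (Vilenkin p))ᶜ, ‖f x‖ₑ ^ 2 ∂μ) ^ (1 / 2 : ℝ) := by
  have hc := (Lp.memLp f).indicator (measurableSet_chain (p := p) m).compl
  rw [fourierChainLp_apply, fourierChainLp_apply, Lp.edist_toLp_toLp, fourierChain_sub_eq_indicator (Lp.memLp f) h, eLpNorm_two_eq,
    lintegral_fourierChain hμ hc]
  refine ENNReal.rpow_le_rpow ?_ (by norm_num)
  refine (setLIntegral_le_lintegral _ _).trans_eq ?_
  rw [← lintegral_indicator (measurableSet_chain m).compl]
  refine lintegral_congr fun x => ?_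
  by_cases hx : x ∈ (chain p m : Set (Vilenkin p))ᶜ <;> simp [hx]

theorem exists_tendsto_fourierChainLp (hμ : μ (chain p 0 : Set (Vilenkin p)) = 1)
    (f : Lp ℂ 2 μ) :
    ∃ F, Tendsto (fun n : ℕ => fourierChainLp hμ (-(n : ℤ)) f) atTop (𝓝 F) := by
  refine cauchySeq_tendsto_of_complete (EMetric.cauchySeq_iff_le_tendsto_0.2
    -- The factor `2` comes from comparing both indices with the common earlier index `N`.
    ⟨fun n : ℕ => 2 * (∫⁻ x in (chain p (-(n : ℤ)) : Set (Vilenkin p))ᶜ,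
      ‖f x‖ₑ ^ 2 ∂μ) ^ (1 / 2 : ℝ), ?_, ?_⟩)
  · intro m n N hm hn
    refine (edist_triangle_right _ _ (fourierChainLp hμ (-(N : ℤ)) f)).trans ?_
    change _ ≤ 2 * _
    rw [two_mul]
    exact add_le_add (edist_fourierChainLp_le hμ f (by omega))
      (edist_fourierChainLp_le hμ f (by omega))
  · have h := tendsto_setLIntegral_compl_chain (lintegral_sq_lt_top (Lp.memLp f)).ne
    have h2 := (ENNReal.continuous_rpow_const (y := 1 / 2)).continuousAt.tendsto.comp h
    have h3 := ENNReal.Tendsto.const_mul (a := 2) h2 (Or.inr (by simp))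
    simpa [Function.comp_def] using h3

/-- The Fourier transform of `L₂(G)`, read on `G` through the self-duality. -/
def fourierLp (hμ : μ (chain p 0 : Set (Vilenkin p)) = 1) : Lp ℂ 2 μ →ₗᵢ[ℂ] Lp ℂ 2 μ where
  toFun f := (exists_tendsto_fourierChainLp hμ f).choose
  map_add' f g := by
    refine tendsto_nhds_unique (exists_tendsto_fourierChainLp hμ (f + g)).choose_spec ?_
    simp only [map_add]
    exact (exists_tendsto_fourierChainLp hμ f).choose_spec.add
      (exists_tendsto_fourierChainLp hμ g).choose_spec
  map_smul' c f := by
    refine tendsto_nhds_unique (exists_tendsto_fourierChainLp hμ (c • f)).choose_spec ?_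
    simp only [map_smul, RingHom.id_apply]
    exact (exists_tendsto_fourierChainLp hμ f).choose_spec.const_smul c
  norm_map' f := by
    have h1 := ENNReal.Tendsto.pow (n := 2) ((continuous_enorm.tendsto _).comp
      (exists_tendsto_fourierChainLp hμ f).choose_spec)
    have h2 := tendsto_setLIntegral_chain μ fun x => ‖f x‖ₑ ^ 2
    simp only [Function.comp_apply, enorm_fourierChainLp_sq] at h1
    have h3 := tendsto_nhds_unique h1 h2
    rw [← eLpNorm_two_sq, ← Lp.enorm_def] at h3
    have h4 := (ENNReal.pow_right_strictMono two_ne_zero).injective h3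
    have h5 := congrArg ENNReal.toReal h4
    rwa [toReal_enorm, toReal_enorm] at h5

theorem tendsto_fourierLp (hμ : μ (chain p 0 : Set (Vilenkin p)) = 1) (f : Lp ℂ 2 μ) :
    Tendsto (fun n : ℕ => fourierChainLp hμ (-(n : ℤ)) f) atTop (𝓝 (fourierLp hμ f)) :=
  (exists_tendsto_fourierChainLp hμ f).choose_spec

end

/-- `F` is the Fourier transform of `f`, read on `G` through the self-duality. -/
def IsFourier (μ : Measure (Vilenkin p)) (f F : Vilenkin p → ℂ) : Prop :=
  MemLp F 2 μ ∧ Tendsto (fun n : ℕ =>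
    eLpNorm (fun y => F y - fourierChain μ (-(n : ℤ)) f y) 2 μ) atTop (𝓝 0)

theorem isL2Fourier_iff {μ : Measure (Vilenkin p)} {ν : Measure (Chars p)}
    (hd : MeasurePreserving dual μ ν) (f : Vilenkin p → ℂ) (F : Chars p → ℂ) :
    IsL2Fourier μ ν f F ↔ IsFourier μ f fun y => F (dual y) := by
  have h : ∀ G : Chars p → ℂ, eLpNorm G 2 ν = eLpNorm (fun y => G (dual y)) 2 μ := fun G => by
    rw [← hd.map_eq, measurableEmbedding_dual.eLpNorm_map_measure]
    rfl
  rw [IsL2Fourier, IsFourier, ← hd.map_eq, measurableEmbedding_dual.memLp_map_measure_iff,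
    hd.map_eq]
  refine and_congr Iff.rfl ?_
  simp only [h, fourierOn_chain_dual]

theorem IsFourier.congr {μ : Measure (Vilenkin p)} {f F F' : Vilenkin p → ℂ}
    (h : IsFourier μ f F) (hF : F =ᵐ[μ] F') : IsFourier μ f F' := by
  refine ⟨h.1.ae_eq hF, h.2.congr fun n => eLpNorm_congr_ae ?_⟩
  filter_upwards [hF] with y hy
  rw [hy]

/-- Uniqueness of limits in `L₂` lets a transform given by an explicit function be used through the
isometry `fourierLp`. -/
theorem isFourier_iff {μ : Measure (Vilenkin p)} [μ.IsAddHaarMeasure]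
    (hμ : μ (chain p 0 : Set (Vilenkin p)) = 1) {f F : Vilenkin p → ℂ} (hf : MemLp f 2 μ)
    (hF : MemLp F 2 μ) : IsFourier μ f F ↔ fourierLp hμ (hf.toLp f) = hF.toLp F := by
  have h : ∀ n : ℕ, eLpNorm (fun y => F y - fourierChain μ (-(n : ℤ)) f y) 2 μ =
      edist (fourierChainLp hμ (-(n : ℤ)) (hf.toLp f)) (hF.toLp F) := fun n => by
    rw [edist_comm, fourierChainLp_apply, Lp.edist_toLp_toLp, fourierChain_congr hf.coeFn_toLp]
    rfl
  simp only [IsFourier, hF, true_and, h, ← tendsto_iff_edist_tendsto_0]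
  exact ⟨fun h => tendsto_nhds_unique (tendsto_fourierLp hμ _) h,
    fun h => h ▸ tendsto_fourierLp hμ _⟩

end Vilenkin

/-! ### Parseval systems and the Fourier transforms of the wavelets. -/

namespace Vilenkin

variable {p : ℕ}

theorem hasSum_norm_sq_of_tsum_enorm_sq {ι : Type*} {E F : Type*} [NormedAddCommGroup E]
    [NormedAddCommGroup F] {c : ι → E} {w : F} (h : ∑' i, ‖c i‖ₑ ^ 2 = ‖w‖ₑ ^ 2) :
    HasSum (fun i => ‖c i‖ ^ 2) (‖w‖ ^ 2) := by
  have hne : ∑' i, ‖c i‖ₑ ^ 2 ≠ ∞ := by rw [h]; finiteness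
  have h1 := ENNReal.hasSum_toReal hne
  rw [← ENNReal.tsum_toReal_eq fun i => by finiteness, h] at h1
  simpa using h1

/-- With `U` the analysis operator, `U* U` and `P` have the same quadratic form, hence coincide over
`ℂ`. Applying `U*` to the expansion of `U v` in unit vectors of `ℓ²` gives the series. -/
theorem hasSum_inner_smul_of_parseval {ι E : Type*} [NormedAddCommGroup E] [InnerProductSpace ℂ E]
    [CompleteSpace E] (g : ι → E) (P : E →ₗ[ℂ] E)
    (hP : ∀ v, inner ℂ (P v) v = ((‖P v‖ ^ 2 : ℝ) : ℂ)) (hPn : ∀ v, ‖P v‖ ≤ ‖v‖)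
    (h : ∀ v, ∑' i, ‖inner ℂ (g i) v‖ₑ ^ 2 = ‖P v‖ₑ ^ 2) (v : E) :
    HasSum (fun i => inner ℂ (g i) v • g i) (P v) := by
  classical
  have hs : ∀ v, HasSum (fun i => ‖inner ℂ (g i) v‖ ^ 2) (‖P v‖ ^ 2) :=
    fun v => hasSum_norm_sq_of_tsum_enorm_sq (h v)
  have hmem : ∀ v, Memℓp (fun i => inner ℂ (g i) v) 2 := fun v =>
    memℓp_gen (by simpa using (hs v).summable)
  let U₀ : E →ₗ[ℂ] lp (fun _ : ι => ℂ) 2 :=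
    { toFun := fun v => ⟨fun i => inner ℂ (g i) v, hmem v⟩
      map_add' := fun v w => by ext i; exact inner_add_right _ _ _
      map_smul' := fun c v => by ext i; exact inner_smul_right _ _ _ }
  have hU₀ : ∀ v i, U₀ v i = inner ℂ (g i) v := fun _ _ => rfl
  have hnorm : ∀ v, ‖U₀ v‖ = ‖P v‖ := fun v => by
    have h1 := lp.norm_rpow_eq_tsum (p := 2) (by norm_num) (U₀ v)
    simp only [ENNReal.toReal_ofNat, Real.rpow_ofNat, hU₀, (hs v).tsum_eq] at h1
    exact (sq_eq_sq₀ (norm_nonneg _) (norm_nonneg _)).1 h1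
  let U : E →L[ℂ] lp (fun _ : ι => ℂ) 2 := U₀.mkContinuous 1 fun v => by
    rw [hnorm, one_mul]
    exact hPn v
  have hU : ∀ v, U v = U₀ v := fun _ => rfl
  have hadj : ((U.adjoint.comp U : E →L[ℂ] E) : E →ₗ[ℂ] E) - P = 0 := by
    refine (inner_map_self_eq_zero _).1 fun v => ?_
    rw [LinearMap.sub_apply, inner_sub_left, hP]
    change inner ℂ (U.adjoint (U v)) v - _ = 0
    rw [ContinuousLinearMap.adjoint_inner_left, inner_self_eq_norm_sq_to_K, hU, hnorm]
    simp
  have hPv : U.adjoint (U v) = P v := by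
    have := LinearMap.congr_fun hadj v
    rw [LinearMap.sub_apply, LinearMap.zero_apply, sub_eq_zero] at this
    exact this
  have hsum := (lp.hasSum_single (p := 2) (by norm_num) (U v)).mapL U.adjoint
  rw [hPv] at hsum
  have hterm : ∀ i, U.adjoint (lp.single 2 i (U v i)) = inner ℂ (g i) v • g i := fun i => by
    refine ext_inner_left ℂ fun u => ?_
    rw [ContinuousLinearMap.adjoint_inner_right, lp.inner_single_right, hU, hU, hU₀, hU₀,
      inner_smul_right, RCLike.inner_apply, inner_conj_symm]
  simpa only [hterm] using hsum

theorem eLpNorm_dilate [NeZero p] {μ : Measure (Vilenkin p)} [μ.IsAddHaarMeasure]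
    (hμ : μ (chain p 0 : Set (Vilenkin p)) = 1) (j : ℤ) (f : Vilenkin p → ℂ) :
    eLpNorm (fun x => f (dilate j x)) 2 μ =
      ENNReal.ofReal ((p : ℝ) ^ (-j)) ^ (1 / 2 : ℝ) * eLpNorm f 2 μ := by
  rw [eLpNorm_two_eq, eLpNorm_two_eq, lintegral_dilate μ hμ j (fun x => ‖f x‖ₑ ^ 2),
    ENNReal.mul_rpow_of_nonneg _ _ (by norm_num)]

/-- The normalisation `p ^ (n / 2)` of the wavelets. -/
def waveletScale (p : ℕ) (n : ℤ) : ℝ := (p : ℝ) ^ ((n : ℝ) / 2)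

theorem waveletScale_sq [NeZero p] (n : ℤ) : waveletScale p n ^ 2 = (p : ℝ) ^ n := by
  rw [waveletScale, ← Real.rpow_natCast, ← Real.rpow_mul (Nat.cast_nonneg p)]
  rw [← Real.rpow_intCast]
  congr 1
  push_cast
  ring

theorem wavelet_apply (ψ : Vilenkin p → ℂ) (n : ℤ) (h x : Vilenkin p) :
    wavelet ψ n h x = (waveletScale p n : ℂ) * ψ (dilate n x - h) := rfl

variable [NeZero p]

/-- The Fourier transform of `ψ_{n,h}` in terms of the Fourier transform of `ψ`. -/
def waveletFourier (F : Vilenkin p → ℂ) (n : ℤ) (h : Vilenkin p) (y : Vilenkin p) : ℂ :=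
  ((p : ℝ) ^ (-n) * waveletScale p n : ℝ) *
    (starRingEnd ℂ) (pairing h (dilate (-n) y)) * F (dilate (-n) y)

theorem memLp_wavelet {μ : Measure (Vilenkin p)} [μ.IsAddHaarMeasure]
    (hμ : μ (chain p 0 : Set (Vilenkin p)) = 1) {ψ : Vilenkin p → ℂ} (hψ : MemLp ψ 2 μ)
    (n : ℤ) (h : Vilenkin p) : MemLp (wavelet ψ n h) 2 μ :=
  (memLp_dilate hμ n (memLp_sub h hψ)).const_mul _

theorem memLp_waveletFourier {μ : Measure (Vilenkin p)} [μ.IsAddHaarMeasure]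
    (hμ : μ (chain p 0 : Set (Vilenkin p)) = 1) {F : Vilenkin p → ℂ} (hF : MemLp F 2 μ)
    (n : ℤ) (h : Vilenkin p) : MemLp (waveletFourier F n h) 2 μ := by
  have hc : Continuous fun y => (starRingEnd ℂ) (pairing h (dilate (-n) y)) :=
    Complex.continuous_conj.comp ((continuous_pairing h).comp (continuous_dilate (-n)))
  have h1 : MemLp (fun y => (starRingEnd ℂ) (pairing h (dilate (-n) y)) * F (dilate (-n) y))
      2 μ := by
    refine (memLp_dilate hμ (-n) hF).of_le
      (hc.aestronglyMeasurable.mul (memLp_dilate hμ (-n) hF).1) (ae_of_all _ fun y => ?_)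
    simp
  have he : waveletFourier F n h = fun y => (((p : ℝ) ^ (-n) * waveletScale p n : ℝ) : ℂ) *
      ((starRingEnd ℂ) (pairing h (dilate (-n) y)) * F (dilate (-n) y)) :=
    funext fun y => mul_assoc _ _ _
  rw [he]
  exact h1.const_mul _

theorem fourierChain_wavelet {μ : Measure (Vilenkin p)} [μ.IsAddHaarMeasure]
    (hμ : μ (chain p 0 : Set (Vilenkin p)) = 1) (f : Vilenkin p → ℂ) (n k : ℤ) {h : Vilenkin p}
    (hh : h ∈ chain p (k - n)) (y : Vilenkin p) :
    fourierChain μ k (wavelet f n h) y = waveletFourier (fourierChain μ (k - n) f) n h y := by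
  have hiff : ∀ x, dilate n x - h ∈ chain p (k - n) ↔ x ∈ chain p k := fun x => by
    rw [sub_eq_add_neg (dilate n x) h, (chain p _).add_mem_cancel_right ((chain p _).neg_mem hh),
      dilate_mem_chain, sub_add_cancel]
  let K : Vilenkin p → ℂ := (chain p (k - n) : Set (Vilenkin p)).indicator fun z =>
    (waveletScale p n : ℂ) * (starRingEnd ℂ) (pairing h (dilate (-n) y)) *
      ((starRingEnd ℂ) (pairing (dilate (-n) y) z) * f z)
  have h1 : ∀ x, (chain p k : Set (Vilenkin p)).indicator
      (fun x => (starRingEnd ℂ) (pairing y x) * wavelet f n h x) x = K (dilate n x - h) := by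
    intro x
    by_cases hx : x ∈ chain p k
    · have hpair : pairing y x = pairing (dilate (-n) y) (dilate n x - h) *
          pairing h (dilate (-n) y) := by
        rw [pairing_comm h, ← pairing_add_right, sub_add_cancel, pairing_dilate, dilate_dilate,
          neg_add_cancel, dilate_zero]
      rw [Set.indicator_of_mem (SetLike.mem_coe.2 hx), hpair]
      simp only [K]
      rw [Set.indicator_of_mem ((hiff x).2 hx), wavelet_apply, map_mul]
      ring
    · simp only [K]
      rw [Set.indicator_of_notMem hx, Set.indicator_of_notMem fun h => hx ((hiff x).1 h)]
  rw [fourierChain, ← integral_indicator (measurableSet_chain k), integral_congr_ae (ae_of_all _ h1),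
    integral_dilate μ hμ n (fun x => K (x - h)), integral_sub_right_eq_self,
    integral_indicator (measurableSet_chain (k - n)), integral_const_mul, waveletFourier,
    fourierChain]
  push_cast
  ring

theorem IsFourier.wavelet {μ : Measure (Vilenkin p)} [μ.IsAddHaarMeasure]
    (hμ : μ (chain p 0 : Set (Vilenkin p)) = 1) {f F : Vilenkin p → ℂ} (hf : IsFourier μ f F)
    (n : ℤ) (h : Vilenkin p) : IsFourier μ (wavelet f n h) (waveletFourier F n h) := by
  refine ⟨memLp_waveletFourier hμ hf.1 n h, ?_⟩
  obtain ⟨m, hm⟩ := exists_mem_chain h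
  -- The integral of `ψ_{n,h}` over `G_{-k}` becomes one of `ψ` over `G_{-k-n}` once that subgroup
  -- contains `h`, so the index of the limit is shifted by `n`.
  have hlim : Tendsto (fun k : ℕ => ((k : ℤ) + n).toNat) atTop atTop := by
    refine tendsto_atTop.2 fun b => ?_
    filter_upwards [eventually_ge_atTop (b + n.natAbs)] with k hk
    omega
  have h1 := ENNReal.Tendsto.const_mul
    (a := ‖(((p : ℝ) ^ (-n) * waveletScale p n : ℝ) : ℂ)‖ₑ *
      ENNReal.ofReal ((p : ℝ) ^ (- -n)) ^ (1 / 2 : ℝ))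
    (hf.2.comp hlim) (Or.inr (by finiteness))
  rw [mul_zero] at h1
  refine h1.congr' ?_
  filter_upwards [eventually_ge_atTop (m + n.natAbs)] with k hk
  have hkn : -(((k : ℤ) + n).toNat : ℤ) = -(k : ℤ) - n := by omega
  rw [Function.comp_apply, hkn, mul_assoc, ← eLpNorm_dilate hμ (-n)
    (fun y => F y - fourierChain μ (-(k : ℤ) - n) f y), ← eLpNorm_const_smul]
  refine eLpNorm_congr_enorm_ae (ae_of_all _ fun y => ?_)
  rw [fourierChain_wavelet hμ f n _ (chain_antitone (by omega) hm), waveletFourier, waveletFourier,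
    ← mul_sub, enorm_mul, enorm_mul, Pi.smul_apply, smul_eq_mul, enorm_mul, RCLike.enorm_conj,
    enorm_pairing, mul_one]

/-- A coset of `G_s` with `s ≥ 0` translates into `G_0`, where extension by zero reduces the claim
to Parseval on `G_0`. The translation costs only a unimodular factor, and the conjugation in `w`
matches the unconjugated character. -/
theorem parseval_ball (μ : Measure (Vilenkin p)) [μ.IsAddHaarMeasure]
    (hμ : μ (chain p 0 : Set (Vilenkin p)) = 1) {v : Vilenkin p → ℂ} (hv : MemLp v 2 μ)
    (a : Vilenkin p) (s : ℕ) :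
    ∑' h : H0 p, ‖∫ x in ball a s, pairing h x * v x ∂μ‖ₑ ^ 2 =
      ∫⁻ x in ball a s, ‖v x‖ₑ ^ 2 ∂μ := by
  let w : Vilenkin p → ℂ := (chain p s : Set (Vilenkin p)).indicator fun x =>
    (starRingEnd ℂ) (v (x - -a))
  have hw : MemLp w 2 μ := ((memLp_sub (-a) hv).star).indicator (measurableSet_chain s)
  have hiff : ∀ x, x - -a ∈ ball a s ↔ x ∈ chain p s := fun x => by simp [mem_ball]
  have hss : (chain p s : Set (Vilenkin p)) ⊆ chain p 0 := chain_antitone (by omega)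
  have hR : ∫⁻ x in ball a s, ‖v x‖ₑ ^ 2 ∂μ =
      ∫⁻ x in (chain p 0 : Set (Vilenkin p)), ‖w x‖ₑ ^ 2 ∂μ := by
    rw [← lintegral_indicator (measurableSet_ball a s),
      ← lintegral_indicator (measurableSet_chain 0),
      ← lintegral_sub_right_eq_self _ (-a)]
    refine lintegral_congr fun x => ?_
    by_cases hx : x ∈ (chain p s : Set (Vilenkin p))
    · rw [Set.indicator_of_mem ((hiff x).2 hx), Set.indicator_of_mem (hss hx)]
      simp only [w]
      rw [Set.indicator_of_mem hx, RCLike.enorm_conj]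
    · rw [Set.indicator_of_notMem fun h => hx ((hiff x).1 h)]
      simp [w, hx, Set.indicator]
  rw [hR, ← parseval_chain_zero μ hμ (hw.restrict _)]
  refine tsum_congr fun h => ?_
  congr 1
  have : ∫ x in ball a s, pairing h x * v x ∂μ = pairing h a * (starRingEnd ℂ)
      (∫ x in (chain p 0 : Set (Vilenkin p)), (starRingEnd ℂ) (pairing h x) * w x ∂μ) := by
    rw [← integral_conj, ← integral_const_mul, ← integral_indicator (measurableSet_ball a s),
      ← integral_indicator (measurableSet_chain 0), ← integral_sub_right_eq_self _ (-a)]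
    refine integral_congr_ae (ae_of_all _ fun x => ?_)
    simp only
    by_cases hx : x ∈ (chain p s : Set (Vilenkin p))
    · rw [Set.indicator_of_mem ((hiff x).2 hx), Set.indicator_of_mem (hss hx)]
      simp only [w]
      rw [Set.indicator_of_mem hx, map_mul, Complex.conj_conj, Complex.conj_conj, ← mul_assoc,
        ← pairing_add_right, sub_neg_eq_add, add_comm a]
    · rw [Set.indicator_of_notMem fun h => hx ((hiff x).1 h)]
      simp [w, hx, Set.indicator]
  rw [this, enorm_mul, enorm_pairing, one_mul, RCLike.enorm_conj]

/-- Substituting `y = 𝒜^n z` turns this into `parseval_ball`. The Jacobian leaves the factor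
`p^{n/2}` in each coefficient; its square `p^n` is the Jacobian of the substitution on the
right-hand side. -/
theorem tsum_inner_waveletFourier (μ : Measure (Vilenkin p)) [μ.IsAddHaarMeasure]
    (hμ : μ (chain p 0 : Set (Vilenkin p)) = 1) {v : Vilenkin p → ℂ} (hv : MemLp v 2 μ)
    (a : Vilenkin p) (s : ℕ) (n : ℤ) :
    ∑' h : H0 p, ‖∫ y, (starRingEnd ℂ) (waveletFourier ((ball a s).indicator fun _ => 1) n h y) *
        v y ∂μ‖ₑ ^ 2 = ∫⁻ y in dilate (-n) ⁻¹' ball a s, ‖v y‖ₑ ^ 2 ∂μ := by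
  have hp : (0 : ℝ) < p := by exact_mod_cast Nat.pos_of_ne_zero (NeZero.ne p)
  have hms : MeasurableSet (dilate (-n) ⁻¹' ball a s) :=
    (measurableEmbedding_dilate (-n)).measurable (measurableSet_ball a s)
  have h1 : ∀ h : H0 p, ∫ y, (starRingEnd ℂ)
      (waveletFourier ((ball a s).indicator fun _ => 1) n h y) * v y ∂μ =
      waveletScale p n * ∫ x in ball a s, pairing h x * v (dilate n x) ∂μ := fun h => by
    have hK : ∀ y, (starRingEnd ℂ) (waveletFourier ((ball a s).indicator fun _ => 1) n h y) *
        v y = (fun z => (((p : ℝ) ^ (-n) * waveletScale p n : ℝ) : ℂ) *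
          (ball a s).indicator (fun z => pairing h z * v (dilate n z)) z) (dilate (-n) y) := by
      intro y
      simp only [waveletFourier]
      by_cases hy : dilate (-n) y ∈ ball a s
      · rw [Set.indicator_of_mem hy, Set.indicator_of_mem hy, mul_one, map_mul, Complex.conj_conj,
          Complex.conj_ofReal, dilate_dilate, add_neg_cancel, dilate_zero, mul_assoc]
      · rw [Set.indicator_of_notMem hy, Set.indicator_of_notMem hy]
        simp
    simp only [hK]
    rw [integral_dilate μ hμ (-n) (fun z => (((p : ℝ) ^ (-n) * waveletScale p n : ℝ) : ℂ) *
          (ball a s).indicator (fun z => pairing h z * v (dilate n z)) z), integral_const_mul,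
      integral_indicator (measurableSet_ball a s), ← mul_assoc, ← Complex.ofReal_mul, ← mul_assoc,
      neg_neg, ← zpow_add₀ hp.ne', add_neg_cancel, zpow_zero, one_mul]
  have hsc : ‖(waveletScale p n : ℂ)‖ₑ ^ 2 = ENNReal.ofReal ((p : ℝ) ^ n) := by
    rw [← waveletScale_sq, ← ofReal_norm, Complex.norm_real, ← ENNReal.ofReal_pow (norm_nonneg _),
      Real.norm_eq_abs, sq_abs]
  simp only [h1, enorm_mul, mul_pow, hsc]
  rw [ENNReal.tsum_mul_left, parseval_ball μ hμ (memLp_dilate hμ n hv),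
    ← lintegral_indicator (measurableSet_ball a s), ← lintegral_indicator hms]
  have h2 : ∀ y, (dilate (-n) ⁻¹' ball a s).indicator (fun y => ‖v y‖ₑ ^ 2) y =
      (fun z => (ball a s).indicator (fun x => ‖v (dilate n x)‖ₑ ^ 2) z) (dilate (-n) y) := by
    intro y
    by_cases hy : dilate (-n) y ∈ ball a s
    · simp only
      rw [Set.indicator_of_mem hy, Set.indicator_of_mem (Set.mem_preimage.2 hy), dilate_dilate,
        add_neg_cancel, dilate_zero]
    · simp only
      rw [Set.indicator_of_notMem (a := y) (fun h => hy h), Set.indicator_of_notMem hy]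
  simp only [h2]
  rw [lintegral_dilate μ hμ (-n) (fun z => (ball a s).indicator
    (fun x => ‖v (dilate n x)‖ₑ ^ 2) z), neg_neg]

end Vilenkin

/-! ### Partial sums as cut-offs in frequency. -/

namespace Vilenkin

variable {p : ℕ}

theorem inner_toLp {α : Type*} [MeasurableSpace α] {μ : Measure α} {w : α → ℂ}
    (hw : MemLp w 2 μ) (v : Lp ℂ 2 μ) :
    inner ℂ (hw.toLp w) v = ∫ x, (starRingEnd ℂ) (w x) * v x ∂μ := by
  rw [L2.inner_def]
  refine integral_congr_ae ?_
  filter_upwards [hw.coeFn_toLp] with x hx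
  rw [hx, RCLike.inner_apply, mul_comm]

/-- Multiplication by the indicator of a measurable set on `L₂`. -/
def indicatorLp {α : Type*} [MeasurableSpace α] {μ : Measure α} {D : Set α}
    (hD : MeasurableSet D) : Lp ℂ 2 μ →ₗ[ℂ] Lp ℂ 2 μ where
  toFun f := ((Lp.memLp f).indicator hD).toLp _
  map_add' f g := by
    rw [← MemLp.toLp_add, MemLp.toLp_eq_toLp_iff]
    filter_upwards [Lp.coeFn_add f g] with x hx
    by_cases hxD : x ∈ D
    · simp only [Pi.add_apply, Set.indicator_of_mem hxD, hx]
    · simp [hxD]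
  map_smul' c f := by
    rw [RingHom.id_apply, ← MemLp.toLp_const_smul, MemLp.toLp_eq_toLp_iff]
    filter_upwards [Lp.coeFn_smul c f] with x hx
    by_cases hxD : x ∈ D
    · simp only [Pi.smul_apply, Set.indicator_of_mem hxD, hx]
    · simp [hxD]

section

variable {α : Type*} [MeasurableSpace α] {μ : Measure α} {D : Set α}

theorem indicatorLp_apply (hD : MeasurableSet D) (f : Lp ℂ 2 μ) :
    indicatorLp hD f = ((Lp.memLp f).indicator hD).toLp _ := rfl

theorem coeFn_indicatorLp (hD : MeasurableSet D) (f : Lp ℂ 2 μ) :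
    indicatorLp hD f =ᵐ[μ] D.indicator f := by
  rw [indicatorLp_apply]
  exact MemLp.coeFn_toLp _

theorem enorm_indicatorLp_sq (hD : MeasurableSet D) (f : Lp ℂ 2 μ) :
    ‖indicatorLp hD f‖ₑ ^ 2 = ∫⁻ x in D, ‖f x‖ₑ ^ 2 ∂μ := by
  rw [indicatorLp_apply, enorm_sq_toLp, ← lintegral_indicator hD]
  refine lintegral_congr fun x => ?_
  by_cases hx : x ∈ D <;> simp [hx]

theorem norm_indicatorLp_le (hD : MeasurableSet D) (f : Lp ℂ 2 μ) :
    ‖indicatorLp hD f‖ ≤ ‖f‖ := by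
  refine Lp.norm_le_norm_of_ae_le ?_
  filter_upwards [coeFn_indicatorLp hD f] with x hx
  rw [hx]
  exact norm_indicator_le_norm_self _ _

theorem inner_indicatorLp_self (hD : MeasurableSet D) (f : Lp ℂ 2 μ) :
    inner ℂ (indicatorLp hD f) f = ((‖indicatorLp hD f‖ ^ 2 : ℝ) : ℂ) := by
  have h := inner_self_eq_norm_sq_to_K (𝕜 := ℂ) (indicatorLp hD f)
  rw [Complex.ofReal_pow, ← RCLike.ofReal_eq_complex_ofReal, ← h, L2.inner_def, L2.inner_def]
  refine integral_congr_ae ?_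
  filter_upwards [coeFn_indicatorLp hD f] with x hx
  rw [hx]
  by_cases hx : x ∈ D <;> simp [hx]

theorem enorm_sub_indicatorLp (hD : MeasurableSet D) (f : Lp ℂ 2 μ) :
    ‖f - indicatorLp hD f‖ₑ = eLpNorm (Dᶜ.indicator f) 2 μ := by
  rw [Lp.enorm_def]
  refine eLpNorm_congr_ae ?_
  filter_upwards [Lp.coeFn_sub f (indicatorLp hD f), coeFn_indicatorLp hD f] with x h1 h2
  rw [h1, Pi.sub_apply, h2]
  by_cases hx : x ∈ D <;> simp [hx]

end

theorem hasL2Sum_of_hasSum {ι : Type} {μ : Measure (Vilenkin p)} {u : ι → Vilenkin p → ℂ}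
    (hu : ∀ i, MemLp (u i) 2 μ) {S : Lp ℂ 2 μ} (h : HasSum (fun i => (hu i).toLp (u i)) S) :
    HasL2Sum μ u S := by
  classical
  refine ⟨hu, Lp.memLp S, ?_⟩
  have hsum : ∀ A : Finset ι, ((∑ i ∈ A, (hu i).toLp (u i) : Lp ℂ 2 μ) : Vilenkin p → ℂ) =ᵐ[μ]
      fun x => ∑ i ∈ A, u i x := by
    intro A
    induction A using Finset.induction_on with
    | empty =>
      simp only [Finset.sum_empty]
      exact Lp.coeFn_zero ℂ 2 μ
    | insert i A hi ih =>
      rw [Finset.sum_insert hi]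
      filter_upwards [Lp.coeFn_add ((hu i).toLp (u i)) (∑ i ∈ A, (hu i).toLp (u i)), ih,
        (hu i).coeFn_toLp] with x h1 h2 h3
      rw [h1, Pi.add_apply, h2, h3, Finset.sum_insert hi]
  have h1 : Tendsto (fun A : Finset ι => edist (∑ i ∈ A, (hu i).toLp (u i)) S) atTop (𝓝 0) :=
    tendsto_iff_edist_tendsto_0.1 h
  refine h1.congr fun A => ?_
  rw [edist_comm, Lp.edist_def]
  refine eLpNorm_congr_ae ?_
  filter_upwards [hsum A] with x hx
  rw [Pi.sub_apply, hx]

/-- Disjointness makes the Parseval identities of the individual pieces add up to the integral over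
their union, so the frame operator on the Fourier side is multiplication by an indicator. The
equality for the error is then the isometry property. -/
theorem exists_isPartialSum [NeZero p] {μ : Measure (Vilenkin p)} [μ.IsAddHaarMeasure]
    (hμ : μ (chain p 0 : Set (Vilenkin p)) = 1) {q : ℕ} {ψ : Fin q → Vilenkin p → ℂ}
    (hψ : ∀ j, MemLp (ψ j) 2 μ) (a : Fin q → Vilenkin p) (s : Fin q → ℕ)
    (hψF : ∀ j, IsFourier μ (ψ j) ((ball (a j) (s j)).indicator fun _ => 1)) (K : ℤ)
    (hd : Pairwise (Function.onFun Disjoint fun i : {n : ℤ // n ≤ K} × Fin q =>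
      (dilate (-i.1.1) ⁻¹' ball (a i.2) (s i.2) : Set (Vilenkin p))))
    {f F : Vilenkin p → ℂ} (hf : MemLp f 2 μ) (hF : IsFourier μ f F) :
    ∃ S, IsPartialSum μ ψ f K S ∧ eLpNorm (fun x => f x - S x) 2 μ =
      eLpNorm ((⋃ i : {n : ℤ // n ≤ K} × Fin q,
        (dilate (-i.1.1) ⁻¹' ball (a i.2) (s i.2) : Set (Vilenkin p)))ᶜ.indicator F) 2 μ := by
  set A : {n : ℤ // n ≤ K} × Fin q → Set (Vilenkin p) := fun i =>
    dilate (-i.1.1) ⁻¹' ball (a i.2) (s i.2) with hA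
  have hAm : ∀ i, MeasurableSet (A i) := fun i =>
    (measurableEmbedding_dilate _).measurable (measurableSet_ball _ _)
  have hD : MeasurableSet (⋃ i, A i) := MeasurableSet.iUnion hAm
  have hw : ∀ i : {n : ℤ // n ≤ K} × Fin q × H0 p, MemLp (wavelet (ψ i.2.1) i.1 i.2.2) 2 μ :=
    fun i => memLp_wavelet hμ (hψ _) _ _
  let w : {n : ℤ // n ≤ K} × Fin q × H0 p → Lp ℂ 2 μ := fun i => (hw i).toLp _
  let T := fourierLp hμ
  have hT : ∀ u v, inner ℂ (T u) (T v) = inner ℂ u v := fun u v => T.inner_map_map u v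
  have hpars : ∀ v : Lp ℂ 2 μ, ∑' i, ‖inner ℂ (T (w i)) v‖ₑ ^ 2 = ‖indicatorLp hD v‖ₑ ^ 2 := by
    intro v
    have hcoef : ∀ i, inner ℂ (T (w i)) v = ∫ y, (starRingEnd ℂ) (waveletFourier
        ((ball (a i.2.1) (s i.2.1)).indicator fun _ => 1) i.1 i.2.2 y) * v y ∂μ := fun i => by
      have h1 := (hψF i.2.1).wavelet hμ i.1 i.2.2
      have h2 := (isFourier_iff hμ (hw i) h1.1).1 h1
      rw [← inner_toLp h1.1]
      exact congrArg (fun z => inner ℂ z v) h2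
    simp only [hcoef]
    rw [ENNReal.tsum_prod', enorm_indicatorLp_sq, lintegral_iUnion hAm hd, ENNReal.tsum_prod']
    refine tsum_congr fun n => ?_
    rw [ENNReal.tsum_prod']
    refine tsum_congr fun j => ?_
    exact tsum_inner_waveletFourier μ hμ (Lp.memLp v) (a j) (s j) n
  let v := T (hf.toLp f)
  have hsum := hasSum_inner_smul_of_parseval (fun i => T (w i)) (indicatorLp hD)
    (inner_indicatorLp_self hD) (norm_indicatorLp_le hD) hpars v
  have hadj : ∀ u, T.toContinuousLinearMap.adjoint (T u) = u := fun u => by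
    refine ext_inner_left ℂ fun z => ?_
    rw [ContinuousLinearMap.adjoint_inner_right]
    exact hT z u
  have hsumS : HasSum (fun i => inner ℂ (w i) (hf.toLp f) • w i)
      (T.toContinuousLinearMap.adjoint (indicatorLp hD v)) := by
    have := hsum.mapL T.toContinuousLinearMap.adjoint
    simpa only [map_smul, hadj, v, hT] using this
  set S := T.toContinuousLinearMap.adjoint (indicatorLp hD v) with hS
  -- `T` is available only as an isometry, so `T T*` cannot simply be cancelled. Instead, the images
  -- under `T` of the terms of the series for `S` are the terms of the expansion of `indicatorLp hD
  -- v`.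
  have hTS : T S = indicatorLp hD v := by
    have h1 := hsumS.mapL T.toContinuousLinearMap
    have h2 : HasSum (fun i => inner ℂ (T (w i)) v • T (w i)) (T S) := by
      simp only [v, hT]
      simpa only [map_smul, LinearIsometry.coe_toContinuousLinearMap] using h1
    exact h2.unique hsum
  have hinner : ∀ i : {n : ℤ // n ≤ K} × Fin q × H0 p,
      inner2 μ f (wavelet (ψ i.2.1) i.1 i.2.2) = inner ℂ (w i) (hf.toLp f) := fun i => by
    rw [inner_toLp, inner2]
    refine integral_congr_ae ?_
    filter_upwards [hf.coeFn_toLp] with x hx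
    rw [hx, mul_comm]
  have hu : ∀ i : {n : ℤ // n ≤ K} × Fin q × H0 p, MemLp (fun x =>
      inner2 μ f (wavelet (ψ i.2.1) i.1 i.2.2) * wavelet (ψ i.2.1) i.1 i.2.2 x) 2 μ :=
    fun i => (hw i).const_mul _
  have huLp : ∀ i, (hu i).toLp _ = inner ℂ (w i) (hf.toLp f) • w i := fun i => by
    rw [← hinner, ← MemLp.toLp_const_smul]
    rfl
  refine ⟨S, hasL2Sum_of_hasSum hu (by simpa only [huLp] using hsumS), ?_⟩
  have hvF : v = hF.1.toLp F := (isFourier_iff hμ hf hF.1).1 hF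
  calc eLpNorm (fun x => f x - S x) 2 μ = ‖hf.toLp f - S‖ₑ := by
        rw [Lp.enorm_def]
        refine eLpNorm_congr_ae ?_
        filter_upwards [Lp.coeFn_sub (hf.toLp f) S, hf.coeFn_toLp] with x h1 h2
        rw [h1, Pi.sub_apply, h2]
    _ = ‖v - indicatorLp hD v‖ₑ := by
        rw [← hTS, ← map_sub, T.enorm_map]
    _ = eLpNorm ((⋃ i, A i)ᶜ.indicator F) 2 μ := by
        rw [enorm_sub_indicatorLp]
        refine eLpNorm_congr_ae ?_
        rw [hvF]
        exact hF.1.coeFn_toLp.indicator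

end Vilenkin

namespace Vilenkin

variable {p : ℕ}

/-! ### Elementary inequalities for the weights -/

theorem one_le_powerWeight {P r : ℝ} (hP : 1 < P) (hr : 0 < r) {N K M l : ℕ} (hM : 1 ≤ M) {L : ℤ}
    (hL : (K : ℤ) + M + 2 ≤ L + l) :
    1 ≤ (N + 1) / ((P ^ r - 1) * P ^ (r * (K + 2))) *
      (1 + P ^ (l * r) * (P ^ L) ^ r) := by
  have hP0 : 0 < P := by linarith
  have ha : 1 < P ^ r := Real.one_lt_rpow hP hr
  have hb : 0 < P ^ (r * (K + 2)) := Real.rpow_pos_of_pos hP0 _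
  have hX : P ^ r * P ^ (r * ((K : ℝ) + 2)) ≤ P ^ (l * r) * (P ^ L) ^ r := by
    rw [← Real.rpow_intCast, ← Real.rpow_mul hP0.le, ← Real.rpow_add hP0, ← Real.rpow_add hP0]
    refine Real.rpow_le_rpow_of_exponent_le hP.le ?_
    have h1 : (K : ℝ) + M + 2 ≤ L + l := by exact_mod_cast hL
    have h2 : (1 : ℝ) ≤ M := by exact_mod_cast hM
    nlinarith
  have hN : (0 : ℝ) ≤ N := Nat.cast_nonneg N
  rw [div_mul_eq_mul_div, one_le_div (mul_pos (by linarith) hb)]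
  nlinarith [mul_pos (zero_lt_one.trans ha) hb]

theorem one_le_powerWeight' {P r : ℝ} (hP : 1 < P) (hr : 0 < r) {N K M l : ℕ} (hM : 1 ≤ M) {L : ℤ}
    (hL : (K : ℤ) + M + 2 ≤ L + l) :
    1 ≤ (N + 1) * P ^ (l * r) / ((P ^ r - 1) * P ^ (r * (K + 2))) *
      (1 + (P ^ L) ^ (r + l)) := by
  have hP0 : 0 < P := by linarith
  have ha : 1 < P ^ r := Real.one_lt_rpow hP hr
  have hb : 0 < P ^ (r * (K + 2)) := Real.rpow_pos_of_pos hP0 _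
  have hX : P ^ r * P ^ (r * ((K : ℝ) + 2)) ≤ P ^ (l * r) * (P ^ L) ^ r := by
    rw [← Real.rpow_intCast, ← Real.rpow_mul hP0.le, ← Real.rpow_add hP0, ← Real.rpow_add hP0]
    refine Real.rpow_le_rpow_of_exponent_le hP.le ?_
    have h1 : (K : ℝ) + M + 2 ≤ L + l := by exact_mod_cast hL
    have h2 : (1 : ℝ) ≤ M := by exact_mod_cast hM
    nlinarith
  -- The summand `1` covers norms at most one; above one the larger exponent dominates.
  have hY : (P ^ L) ^ r ≤ 1 + (P ^ L) ^ (r + l) := by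
    rcases le_total 1 (P ^ L) with h | h
    · have := Real.rpow_le_rpow_of_exponent_le h (show r ≤ r + l by simp)
      linarith
    · have h1 := Real.rpow_le_one (zpow_nonneg hP0.le L) h hr.le
      have h2 := Real.rpow_nonneg (zpow_nonneg hP0.le L) (r + l)
      linarith
  have hN : (0 : ℝ) ≤ N := Nat.cast_nonneg N
  have hl : 0 < P ^ (l * r) := Real.rpow_pos_of_pos hP0 _
  have hZ := mul_le_mul_of_nonneg_left hY hl.le
  rw [div_mul_eq_mul_div, one_le_div (mul_pos (by linarith) hb)]
  have hpos : 0 ≤ P ^ (l * r) * (1 + (P ^ L) ^ (r + l)) :=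
    mul_nonneg hl.le (by linarith [Real.rpow_nonneg (zpow_nonneg hP0.le L) (r + l)])
  nlinarith [mul_nonneg hN hpos]

theorem one_le_logWeight {ε Z : ℝ} (hε : 0 < ε) {N K : ℕ} (hZ : (K : ℝ) + 4 ≤ Z) :
    1 ≤ 2 * (N + 1) / (ε * (1 + (K : ℝ)) ^ (ε / 2)) * Z ^ (1 + ε / 2) := by
  have hN : (0 : ℝ) ≤ N := Nat.cast_nonneg N
  have hK : (0 : ℝ) ≤ K := Nat.cast_nonneg K
  obtain ⟨x, hx⟩ : ∃ x : ℝ, x = 1 + (K : ℝ) := ⟨_, rfl⟩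
  obtain ⟨δ, hδ⟩ : ∃ δ : ℝ, δ = ε / 2 := ⟨_, rfl⟩
  have hx0 : 0 < x := by linarith
  have hδ0 : 0 < δ := by linarith
  have hZ0 : 0 < Z := by linarith
  have hxd : 0 < x ^ δ := Real.rpow_pos_of_pos hx0 _
  rw [← hx, ← hδ, div_mul_eq_mul_div, one_le_div (mul_pos hε hxd), Real.rpow_add hZ0,
    Real.rpow_one]
  have h1 : x ^ δ * (1 + 3 / x) ^ δ ≤ Z ^ δ := by
    rw [← Real.mul_rpow hx0.le (by positivity)]
    refine Real.rpow_le_rpow (by positivity) ?_ hδ0.le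
    rw [mul_add, mul_div_cancel₀ _ hx0.ne']
    linarith
  -- For large `δ` the factor `x + 3` alone is not enough. Bernoulli's inequality supplies growth
  -- linear in `δ`, which is where the margin `3` between `Z` and `x` is needed.
  have h2 : δ ≤ (x + 3) * (1 + 3 / x) ^ δ := by
    rcases le_total 1 δ with h | h
    · have h3 := one_add_mul_self_le_rpow_one_add
        (show (-1 : ℝ) ≤ 3 / x by linarith [show 0 < 3 / x by positivity]) h
      have h4 : x * (3 / x) = 3 := mul_div_cancel₀ _ hx0.ne'
      have h5 : 0 < 3 / x := by positivity
      nlinarith [mul_pos hδ0 h5]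
    · have h3 : (1 : ℝ) ≤ (1 + 3 / x) ^ δ :=
        Real.one_le_rpow (by linarith [show 0 < 3 / x by positivity]) hδ0.le
      nlinarith
  have h3 : δ * x ^ δ ≤ Z * Z ^ δ := by
    calc δ * x ^ δ ≤ (x + 3) * (1 + 3 / x) ^ δ * x ^ δ := by gcongr
      _ = (x + 3) * (x ^ δ * (1 + 3 / x) ^ δ) := by ring
      _ ≤ Z * Z ^ δ := mul_le_mul (by linarith) h1 (by positivity) hZ0.le
  have h4 : 0 ≤ Z * Z ^ δ := (mul_nonneg hδ0.le hxd.le).trans h3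
  have h5 : ε = 2 * δ := by linarith
  rw [h5]
  nlinarith [mul_nonneg hN h4]

theorem one_le_stepWeight {γ : ℤ → ℝ} (hpos : ∀ n, 0 < γ n) (hmono : MonotoneOn γ (Set.Ici 0))
    (hsum : Summable fun n : ℕ => 1 / γ n) {c : ℝ} (hc : 1 ≤ c) {K : ℕ} {n : ℤ}
    (hn : (K : ℤ) + 2 ≤ n) :
    1 ≤ c * (∑' k : ℕ, 1 / γ ((K : ℤ) + 1 + k + 1)) * γ n := by
  have hs : Summable fun k : ℕ => 1 / γ ((K : ℤ) + 1 + k + 1) := by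
    refine ((summable_nat_add_iff (K + 2)).2 hsum).congr fun k => ?_
    congr 2
    push_cast
    ring
  -- The first term of the tail suffices: `γ n` is at least its reciprocal.
  have h1 : 1 / γ ((K : ℤ) + 2) ≤ ∑' k : ℕ, 1 / γ ((K : ℤ) + 1 + k + 1) := by
    have := hs.le_tsum 0 fun k _ => (one_div_pos.2 (hpos _)).le
    simpa [add_assoc] using this
  have h2 : γ ((K : ℤ) + 2) ≤ γ n :=
    hmono (Set.mem_Ici.2 (by omega)) (Set.mem_Ici.2 (by omega)) hn
  have h3 := hpos ((K : ℤ) + 2)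
  have h4 : 1 / γ ((K : ℤ) + 2) * γ ((K : ℤ) + 2) = 1 := one_div_mul_cancel h3.ne'
  calc (1 : ℝ) ≤ c * (1 / γ ((K : ℤ) + 2) * γ ((K : ℤ) + 2)) := by rw [h4, mul_one]; exact hc
    _ ≤ c * ((∑' k : ℕ, 1 / γ ((K : ℤ) + 1 + k + 1)) * γ n) := by
        gcongr
        exact (one_div_pos.2 h3).le.trans h1
    _ = _ := by ring

/-! ### Levels of characters -/

theorem charNorm_eq {χ : Chars p} {L : ℤ} (hχ : χ ≠ 1) (h : χ ∈ annih p L)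
    (h' : χ ∉ annih p (L - 1)) : charNorm χ = (p : ℝ) ^ L := by
  rw [charNorm, if_neg hχ, level_eq h h']

variable [NeZero p]

theorem exists_level {χ : Chars p} (hχ : χ ≠ 1) :
    ∃ L : ℤ, χ ∈ annih p L ∧ χ ∉ annih p (L - 1) := by
  obtain ⟨y, rfl⟩ := dual_surjective χ
  obtain ⟨n, hn⟩ := exists_mem_annih (dual y)
  have hb : ∃ b : ℤ, ∀ z : ℤ, dual y ∈ annih p z → b ≤ z := by
    have hy : ∃ k : ℕ, y ∉ chain p k := by
      by_contra! h
      rw [eq_zero_of_forall_mem_chain h, dual_zero] at hχ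
      exact hχ rfl
    obtain ⟨k, hk⟩ := hy
    refine ⟨-k, fun z hz => ?_⟩
    by_contra hlt
    exact hk (chain_antitone (by omega) (dual_mem_annih.1 hz))
  obtain ⟨L, hL, hmin⟩ := Int.exists_least_of_bdd hb ⟨n, hn⟩
  refine ⟨L, hL, fun h => ?_⟩
  have := hmin _ h
  omega

theorem dualDilate_mem_annih {j n : ℤ} {χ : Chars p} :
    dualDilate j χ ∈ annih p (n + j) ↔ χ ∈ annih p n := by
  obtain ⟨y, rfl⟩ := dual_surjective χ
  rw [← dual_dilate, dual_mem_annih, dual_mem_annih, dilate_mem_chain]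
  ring_nf

theorem level_dualDilate {χ : Chars p} {L : ℤ} (h : χ ∈ annih p L) (h' : χ ∉ annih p (L - 1))
    (j : ℤ) : level (dualDilate j χ) = L + j :=
  level_eq (dualDilate_mem_annih.2 h) fun hm => h' <| by
    rwa [add_sub_right_comm, dualDilate_mem_annih] at hm

theorem dual_mem_image_dualDilate {E : Set (Chars p)} {j : ℤ} {y : Vilenkin p} :
    dual y ∈ dualDilate j '' E ↔ dual (dilate (-j) y) ∈ E := by
  constructor
  · rintro ⟨χ, hχ, h⟩
    obtain ⟨z, rfl⟩ := dual_surjective χ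
    rw [← dual_dilate] at h
    rwa [← dual_injective h, dilate_dilate, neg_add_cancel, dilate_zero]
  · intro h
    refine ⟨_, h, ?_⟩
    rw [← dual_dilate, dilate_dilate, add_neg_cancel, dilate_zero]

/-! ### From pointwise bounds on weights to weighted norms. -/

theorem measure_singleton_zero [Fact p.Prime] (μ : Measure (Vilenkin p)) [μ.IsAddHaarMeasure]
    (hμ : μ (chain p 0 : Set (Vilenkin p)) = 1) : μ {0} = 0 := by
  have hp : (1 : ℝ) < p := by exact_mod_cast (Fact.out : p.Prime).one_lt
  have h1 : Tendsto (fun n : ℕ => ENNReal.ofReal ((p : ℝ)⁻¹ ^ n)) atTop (𝓝 0) := by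
    have := tendsto_pow_atTop_nhds_zero_of_lt_one (inv_nonneg.2 (by linarith : (0 : ℝ) ≤ p))
      (inv_lt_one_of_one_lt₀ hp)
    simpa using ENNReal.tendsto_ofReal this
  refine le_antisymm (ge_of_tendsto' h1 fun n => ?_) zero_le
  have h2 := measure_chain μ hμ n
  rw [zpow_neg, zpow_natCast, ← inv_pow] at h2
  rw [← h2]
  exact measure_mono (Set.singleton_subset_iff.2 (chain p n).zero_mem)

theorem weightedNorm_eq {μ : Measure (Vilenkin p)} {ν : Measure (Chars p)}
    (hd : MeasurePreserving dual μ ν) (w : Chars p → ℝ) (F : Chars p → ℂ) :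
    weightedNorm ν w F =
      (∫⁻ y, ENNReal.ofReal (w (dual y) ^ 2 * ‖F (dual y)‖ ^ 2) ∂μ) ^ (1 / 2 : ℝ) := by
  rw [weightedNorm, ← hd.map_eq, measurableEmbedding_dual.lintegral_map]

theorem eLpNorm_indicator_le_weightedNorm {μ : Measure (Vilenkin p)} {ν : Measure (Chars p)}
    (hd : MeasurePreserving dual μ ν) {D : Set (Vilenkin p)} {w : Chars p → ℝ} {C : ℝ}
    (hC : 0 ≤ C) (h : ∀ᵐ y ∂μ, y ∈ D → 1 ≤ C * w (dual y)) (F : Chars p → ℂ) :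
    eLpNorm (D.indicator fun y => F (dual y)) 2 μ ≤ ENNReal.ofReal C * weightedNorm ν w F := by
  have hle : ∫⁻ y, ‖D.indicator (fun y => F (dual y)) y‖ₑ ^ 2 ∂μ ≤ ENNReal.ofReal C ^ 2 *
      ∫⁻ y, ENNReal.ofReal (w (dual y) ^ 2 * ‖F (dual y)‖ ^ 2) ∂μ := by
    rw [← lintegral_const_mul' _ _ (by finiteness)]
    refine lintegral_mono_ae ?_
    filter_upwards [h] with y hy
    by_cases hyD : y ∈ D
    · rw [Set.indicator_of_mem hyD, ← ofReal_norm, ← ENNReal.ofReal_pow (norm_nonneg _),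
        ← ENNReal.ofReal_pow hC, ← ENNReal.ofReal_mul (by positivity), ← mul_assoc, ← mul_pow]
      refine ENNReal.ofReal_le_ofReal ?_
      exact le_mul_of_one_le_left (by positivity) (one_le_pow₀ (hy hyD))
    · simp [hyD]
  rw [eLpNorm_two_eq, weightedNorm_eq hd]
  refine (ENNReal.rpow_le_rpow hle (by norm_num)).trans_eq ?_
  rw [ENNReal.mul_rpow_of_nonneg _ _ (by norm_num), ← ENNReal.rpow_natCast, ← ENNReal.rpow_mul]
  norm_num

end Vilenkin

/-! ### The dilates of the sets `E j` and the levels they reach. -/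

namespace Vilenkin

variable {p : ℕ}

/-- Undoing the dilation by `n` and then dilating by `t j` lands in the shell of level `M + 1`, and
each dilation shifts the level by its exponent. -/
theorem level_of_dilate_mem [NeZero p] {M q : ℕ} {E : Fin q → Set (Chars p)} {t : Fin q → ℕ}
    (hU : ⋃ j, dualDilate (t j : ℤ) '' E j
      = (annih p ((M : ℤ) + 1) : Set (Chars p)) \ (annih p (M : ℤ) : Set (Chars p)))
    {y : Vilenkin p} {n : ℤ} {j : Fin q} (h : dual (dilate (-n) y) ∈ E j) :
    level (dual y) = M + 1 + n - t j := by
  have h1 : dual (dilate (t j - n) y) ∈ ⋃ j, dualDilate (t j : ℤ) '' E j := by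
    refine Set.mem_iUnion.2 ⟨j, dual_mem_image_dualDilate.2 ?_⟩
    rwa [dilate_dilate, show -(t j : ℤ) + (t j - n) = -n by ring]
  rw [hU, Set.mem_sdiff, SetLike.mem_coe, SetLike.mem_coe, dual_mem_annih, dual_mem_annih,
    dilate_mem_chain, dilate_mem_chain] at h1
  refine level_eq (dual_mem_annih.2 ?_) fun h2 => h1.2 ?_
  · convert h1.1 using 2; ring
  · convert dual_mem_annih.1 h2 using 2; ring

/-- Comparing levels gives `n - t j = n' - t j'`, so both memberships refer to the same point of the
shell of level `M + 1`, whose pieces are disjoint. -/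
theorem pairwise_disjoint_dilated [NeZero p] {M q : ℕ} {E : Fin q → Set (Chars p)} {t : Fin q → ℕ}
    (hU : ⋃ j, dualDilate (t j : ℤ) '' E j
      = (annih p ((M : ℤ) + 1) : Set (Chars p)) \ (annih p (M : ℤ) : Set (Chars p)))
    (hd : Pairwise fun i j =>
      Disjoint (dualDilate (t i : ℤ) '' E i) (dualDilate (t j : ℤ) '' E j))
    {n n' : ℤ} {j j' : Fin q} {y : Vilenkin p} (h : dual (dilate (-n) y) ∈ E j)
    (h' : dual (dilate (-n') y) ∈ E j') : n = n' ∧ j = j' := by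
  have h1 := (level_of_dilate_mem hU h).symm.trans (level_of_dilate_mem hU h')
  have hj : j = j' := by
    by_contra hne
    refine Set.disjoint_left.1 (hd hne)
      (?_ : dual (dilate (t j - n) y) ∈ dualDilate (t j : ℤ) '' E j) ?_
    · refine dual_mem_image_dualDilate.2 ?_
      rwa [dilate_dilate, show -(t j : ℤ) + (t j - n) = -n by ring]
    · refine dual_mem_image_dualDilate.2 ?_
      rwa [dilate_dilate, show -(t j' : ℤ) + (t j - n) = -n' by linarith]
  subst hj
  exact ⟨by linarith, rfl⟩

/-- Dilated to level `M + 1`, the character lies in some piece `j` of the shell, hence in `E j 𝒜^n`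
with `n = L + t j - M - 1`. By hypothesis this `n` exceeds `K`, and `t j` is at most the supremum.
-/
theorem le_level_of_forall_not_mem [NeZero p] {M q : ℕ} {E : Fin q → Set (Chars p)}
    {t : Fin q → ℕ}
    (hU : ⋃ j, dualDilate (t j : ℤ) '' E j
      = (annih p ((M : ℤ) + 1) : Set (Chars p)) \ (annih p (M : ℤ) : Set (Chars p)))
    {y : Vilenkin p} {K L : ℤ} (h : ∀ n ≤ K, ∀ j, dual (dilate (-n) y) ∉ E j)
    (hL : dual y ∈ annih p L) (hL' : dual y ∉ annih p (L - 1)) :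
    K + M + 2 ≤ L + (Finset.univ.sup t : ℕ) := by
  have h1 : dual (dilate (M + 1 - L) y) ∈ ⋃ j, dualDilate (t j : ℤ) '' E j := by
    rw [hU, Set.mem_sdiff, SetLike.mem_coe, SetLike.mem_coe, dual_mem_annih, dual_mem_annih,
      dilate_mem_chain, dilate_mem_chain]
    rw [dual_mem_annih] at hL hL'
    refine ⟨?_, fun h2 => hL' ?_⟩
    · convert hL using 2; ring
    · convert h2 using 2; ring
  obtain ⟨j, hj⟩ := Set.mem_iUnion.1 h1
  rw [dual_mem_image_dualDilate, dilate_dilate,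
    show -(t j : ℤ) + (M + 1 - L) = -(L + t j - M - 1) by ring] at hj
  have h2 : t j ≤ Finset.univ.sup t := Finset.le_sup (Finset.mem_univ j)
  by_contra hlt
  exact h _ (by omega) j hj

end Vilenkin

end

/-! ### The error estimates. -/

open Vilenkin

theorem mainTheorem4 (p : ℕ) [Fact p.Prime]
    (μ : Measure (Vilenkin p)) [μ.IsAddHaarMeasure]
    (hμ : μ (Vilenkin.chain p 0 : Set (Vilenkin p)) = 1)
    (ν : Measure (Vilenkin.Chars p)) [ν.IsHaarMeasure]
    (hν : ν (Vilenkin.annih p 0 : Set (Vilenkin.Chars p)) = 1)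
    (M N q : ℕ) (hM : 1 ≤ M) (hN : 1 ≤ N)
    (φ : Vilenkin p → ℂ) (m : Fin q → Vilenkin.Chars p → ℂ)
    (E : Fin q → Set (Vilenkin.Chars p)) (t : Fin q → ℕ) (ψ : Fin q → Vilenkin p → ℂ)
    (hψ : Vilenkin.IsStepWaveletSystem μ ν M N q φ m E t ψ)
    (l : ℕ) (hl : l = Finset.univ.sup t)
    (f : Vilenkin p → ℂ) (hf : MemLp f 2 μ) :
    ∃ F : Vilenkin.Chars p → ℂ, Vilenkin.IsL2Fourier μ ν f F ∧
      ∀ K : ℕ, N < K → ∃ S : Vilenkin p → ℂ, Vilenkin.IsPartialSum μ ψ f K S ∧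
        -- general weight
        (∀ γ : ℤ → ℝ, (∀ n, 0 < γ n) → (∀ n < 0, γ n = 1) → MonotoneOn γ (Set.Ici 0) →
          Summable (fun n : ℕ => 1 / γ n) →
          eLpNorm (fun x => f x - S x) 2 μ ≤
            ENNReal.ofReal ((N + 1) * (p : ℝ) ^ ((M : ℝ) / 2)) *
              Vilenkin.weightedNorm ν
                (fun χ => Vilenkin.stepWeight γ (Vilenkin.dualDilate l χ)) F *
              ENNReal.ofReal (∑' k : ℕ, 1 / γ ((K : ℤ) + 1 + k + 1))) ∧
        -- power weight
        (∀ r : ℝ, 0 < r →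
          eLpNorm (fun x => f x - S x) 2 μ ≤
            ENNReal.ofReal ((N + 1) / (((p : ℝ) ^ r - 1) * (p : ℝ) ^ (r * (K + 2)))) *
              Vilenkin.weightedNorm ν
                (fun χ => 1 + (p : ℝ) ^ (l * r) * Vilenkin.charNorm χ ^ r) F ∧
          eLpNorm (fun x => f x - S x) 2 μ ≤
            ENNReal.ofReal ((N + 1) * (p : ℝ) ^ (l * r) /
                (((p : ℝ) ^ r - 1) * (p : ℝ) ^ (r * (K + 2)))) *
              Vilenkin.weightedNorm ν
                (fun χ => 1 + Vilenkin.charNorm χ ^ (r + l)) F) ∧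
        -- logarithmic weight
        (∀ ε : ℝ, 0 < ε →
          eLpNorm (fun x => f x - S x) 2 μ ≤
            ENNReal.ofReal (2 * (N + 1) / (ε * (1 + (K : ℝ)) ^ (ε / 2))) *
              Vilenkin.weightedNorm ν
                (fun χ => (1 + l + Vilenkin.logPlus χ) ^ (1 + ε / 2)) F) := by

  have hd := measurePreserving_dual μ hμ ν hν
  have hp : (1 : ℝ) < p := by exact_mod_cast (Fact.out : p.Prime).one_lt
  have hex : ∃ F : Chars p → ℂ, IsL2Fourier μ ν f F := by
    refine ⟨fun χ => fourierLp hμ (hf.toLp f) (dualEquiv.symm χ), (isL2Fourier_iff hd f _).2 ?_⟩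
    simp only [dualEquiv_symm_dual]
    refine (isFourier_iff hμ hf (Lp.memLp _)).2 ?_
    rw [Lp.toLp_coeFn]
  obtain ⟨F, hF⟩ := hex
  refine ⟨F, hF, fun K _ => ?_⟩
  choose s χ₀ hE using hψ.coset
  choose a ha using fun j => dual_surjective (χ₀ j)
  have hmem : ∀ j y, dual y ∈ E j ↔ y ∈ ball (a j) (s j) := fun j y => by
    rw [hE j, mem_ball]
    change dual y * (χ₀ j)⁻¹ ∈ annih p (-(s j : ℤ)) ↔ _
    rw [← ha j, ← dual_sub, dual_mem_annih, neg_neg]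
  have hψF : ∀ j, IsFourier μ (ψ j) ((ball (a j) (s j)).indicator fun _ => 1) := fun j => by
    refine ((isL2Fourier_iff hd _ _).1 (hψ.wavelet_fourier j)).congr ?_
    filter_upwards [hd.quasiMeasurePreserving.ae (hψ.mask j)] with y hy
    rw [hy]
    by_cases h : dual y ∈ E j
    · rw [Set.indicator_of_mem h, Set.indicator_of_mem ((hmem j y).1 h)]
    · rw [Set.indicator_of_notMem h, Set.indicator_of_notMem (fun h' => h ((hmem j y).2 h'))]
  have hdisj : Pairwise (Function.onFun Disjoint fun i : {n : ℤ // n ≤ (K : ℤ)} × Fin q =>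
      (dilate (-i.1.1) ⁻¹' ball (a i.2) (s i.2) : Set (Vilenkin p))) := by
    rintro ⟨⟨n, hn⟩, j⟩ ⟨⟨n', hn'⟩, j'⟩ hne
    refine Set.disjoint_left.2 fun y hy hy' => hne ?_
    obtain ⟨rfl, rfl⟩ := pairwise_disjoint_dilated hψ.iUnion_dilated hψ.disjoint_dilated
      ((hmem j _).2 hy) ((hmem j' _).2 hy')
    rfl
  obtain ⟨S, hS, hR⟩ := exists_isPartialSum hμ hψ.wavelet_memLp a s hψF K hdisj hf
    ((isL2Fourier_iff hd f F).1 hF)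
  -- All four bounds reduce to checking `1 ≤ C * w χ` on characters of level at least `K + M + 2 -
  -- l`. The trivial character, which has no level, is a null set.
  have key : ∀ (w : Chars p → ℝ) (C : ℝ), 0 ≤ C →
      (∀ (χ : Chars p) (L : ℤ), χ ≠ 1 → χ ∈ annih p L → χ ∉ annih p (L - 1) →
        (K : ℤ) + M + 2 ≤ L + l → 1 ≤ C * w χ) →
      eLpNorm (fun x => f x - S x) 2 μ ≤ ENNReal.ofReal C * weightedNorm ν w F := by
    intro w C hC hw
    rw [hR]
    refine eLpNorm_indicator_le_weightedNorm hd hC ?_ F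
    filter_upwards [measure_eq_zero_iff_ae_notMem.1 (measure_singleton_zero μ hμ)] with y hy hyD
    have hy1 : dual y ≠ 1 := fun h => hy (dual_injective (h.trans dual_zero.symm))
    obtain ⟨L, hL, hL'⟩ := exists_level hy1
    refine hw _ L hy1 hL hL' ?_
    rw [hl]
    refine le_level_of_forall_not_mem hψ.iUnion_dilated (fun n hn j hj => hyD ?_) hL hL'
    exact Set.mem_iUnion.2 ⟨(⟨n, hn⟩, j), (hmem j _).1 hj⟩
  refine ⟨S, hS, fun γ hpos _ hmono hsum => ?_, fun r hr => ⟨?_, ?_⟩, fun ε hε => ?_⟩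
  · have hT : 0 ≤ ∑' k : ℕ, 1 / γ ((K : ℤ) + 1 + k + 1) :=
      tsum_nonneg fun k => (one_div_pos.2 (hpos _)).le
    -- The tail sum is absorbed into the constant `C`.
    rw [mul_right_comm, ← ENNReal.ofReal_mul (by positivity)]
    refine key _ _ (by positivity) fun χ L _ hL hL' hle => ?_
    rw [stepWeight, level_dualDilate hL hL']
    refine one_le_stepWeight hpos hmono hsum ?_ (by omega)
    have h1 : (1 : ℝ) ≤ (p : ℝ) ^ ((M : ℝ) / 2) := Real.one_le_rpow hp.le (by positivity)
    have h2 : (0 : ℝ) ≤ N := Nat.cast_nonneg N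
    nlinarith
  · have h1 : 0 < (p : ℝ) ^ r - 1 := sub_pos.2 (Real.one_lt_rpow hp hr)
    refine key _ _ (by positivity) fun χ L hχ hL hL' hle => ?_
    rw [charNorm_eq hχ hL hL']
    exact one_le_powerWeight hp hr hM hle
  · have h1 : 0 < (p : ℝ) ^ r - 1 := sub_pos.2 (Real.one_lt_rpow hp hr)
    refine key _ _ (by positivity) fun χ L hχ hL hL' hle => ?_
    rw [charNorm_eq hχ hL hL']
    exact one_le_powerWeight' hp hr hM hle
  · refine key _ _ (by positivity) fun χ L hχ hL hL' hle => one_le_logWeight hε ?_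
    have hle' : (K : ℝ) + M + 2 ≤ L + l := by exact_mod_cast hle
    have hM' : (1 : ℝ) ≤ M := by exact_mod_cast hM
    rw [logPlus, charNorm_eq hχ hL hL']
    split_ifs with h
    · rw [← Real.rpow_intCast, Real.logb_rpow (by linarith) hp.ne']
      linarith
    -- Where the logarithm is replaced by `1` the level is nonpositive, so `l` alone already exceeds
    -- `K + 2`.
    · have hL0 : L ≤ 0 := by
        by_contra! h'
        exact h (one_lt_zpow₀ hp h')
      have : (L : ℝ) ≤ 0 := by exact_mod_cast hL0
      linarith
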